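/- **Theorem (Universal approximation).** Let $n\ge 1$, $D=(-1,1)^n$, and let $f:\mathbb R^n\to\mathbb R^n$ be Lipschitz continuous with $f(0)=0$ and $f(x)=Ax+o(\|x\|)$ as $x\to0$, where all eigenvalues of $A\in\mathbb R^{n\times n}$ have strictly negative real part. A function $V$ that is continuous on $\overline D$ and continuously differentiable on $D$ is called a *Lyapunov function* (for $f$ on $D$) if $V(0)=0$; $V(x)>0$ for all $x\in D\setminus\{0\}$; $\nabla V(x)\cdot f(x)<0$ for all $x\in D\setminus\{0\}$ with $V(x)<1$; and $V(x)\ge 1$ at every $x\in\partial D$ at which $f(x)\cdot\nu\ge 0$ for some outgoing normal vector $\nu$ of $D$ at $x$ (that is, some $\nu\neq0$ with $\nu\cdot(y-x)\le 0$ for all $y\in D$). Put $\mathcal R(V)=\{x\in D: V(x)<1\}$. A Lyapunov function $V^*$ is called *maximal* if there is a continuous $\varphi:\overline D\to\mathbb R$ with $\varphi(0)=0$ and $\varphi>0$ on $\overline D\setminus\{0\}$ such that $$\nabla V^*(x)\cdot f(x)=-\varphi(x)\,(1-V^*(x))\qquad\text{for all }x\in D .$$ Let $\psi\in C^\infty(\mathbb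 R,\mathbb R)$ be nonconstant and bounded together with its derivatives up to order $3$, and let $N_l\ge1$. For a width $N\ge1$ and parameters $\Theta=\{(W_j,b_j)\}_{j=0,\dots,N_l+1}$ with $W_0\in\mathbb R^{N\times n}$, $W_1,\dots,W_{N_l}\in\mathbb R^{N\times N}$, $W_{N_l+1}\in\mathbb R^{n^3\times N}$, $b_0,\dots,b_{N_l}\in\mathbb R^N$, $b_{N_l+1}\in\mathbb R^{n^3}$, let $$\hat R_N(x)=W_{N_l+1}\,\bigl(H_{W_{N_l},b_{N_l}}\circ\cdots\circ H_{W_0,b_0}\bigr)(x)+b_{N_l+1},\qquad H_{W,b}(x)=\psi(Wx+b)\ \text{(componentwise)}.$$ Let $\mathcal I=\{i\in\{0,1,2,3\}^n:\ i_1+\dots+i_n=3\}$ and let $(e_i)_{i\in\mathcal I}$ be a given linearly independent family in $\mathbb R^{n^3}$ (for instance distinct standard basis vectors). For a symmetric matrix $P\in\mathbb R^{n\times n}$ define the Taylor-neural function $$\hat V(x)=\tfrac12x^\top Px+\sum_{i\in\mathcal I}\langle\hat R_N(x),e_i\rangle\prod_{k=1}^n x_k^{i_k}.$$ Let $V^*$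 be a maximal Lyapunov function. Then for every $\varepsilon\in(0,1)$ there exist $N\ge1$, a matrix $P\succ0$ with $A^\top P+PA\prec0$, and parameters $\Theta$ such that $\hat V$ is a Lyapunov function and $$\{x\in D:\ V^*(x)\le 1-\varepsilon\}\subseteq\mathcal R(\hat V)\subseteq\mathcal R(V^*).$$ -/

import Mathlib

open scoped Matrix Topology

namespace TaylorNeural

/-- The state space `ℝⁿ` with the Euclidean norm. -/
abbrev State (n : ℕ) : Type := EuclideanSpace ℝ (Fin n)

/-- The open cube `D = (-1, 1)ⁿ`. -/
def cube (n : ℕ) : Set (State n) := {x | ∀ k, x k ∈ Set.Ioo (-1 : ℝ) 1}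

/-- `ν` is an outgoing normal vector to the cube at `x`: it is nonzero and the (convex) cube lies
in the half-space `{y | ⟪ν, y - x⟫ ≤ 0}`. At a boundary point in the interior of a face this is the
usual outgoing normal up to a positive factor; on edges and corners there are several. -/
def IsOutgoingNormal {n : ℕ} (x ν : State n) : Prop :=
  ν ≠ 0 ∧ ∀ y ∈ cube n, inner ℝ ν (y - x) ≤ 0

/-- Local Lyapunov functions for `f` on the cube. The values on the boundary are those of the
continuous extension, which is why continuity is required on the closed cube. -/
structure IsLyapunovFunction {n : ℕ} (f : State n → State n) (V : State n → ℝ) : Prop where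
  contDiffOn : ContDiffOn ℝ 1 V (cube n)
  continuousOn : ContinuousOn V (closure (cube n))
  map_zero : V 0 = 0
  pos : ∀ x ∈ cube n, x ≠ 0 → 0 < V x
  decreasing : ∀ x ∈ cube n, x ≠ 0 → V x < 1 → fderiv ℝ V x (f x) < 0
  boundary : ∀ x ∈ frontier (cube n), ∀ ν, IsOutgoingNormal x ν →
    0 ≤ inner ℝ (f x) ν → 1 ≤ V x

/-- The set `R(V) = {x ∈ D | V x < 1}`. -/
def basin {n : ℕ} (V : State n → ℝ) : Set (State n) := {x | x ∈ cube n ∧ V x < 1}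

/-- Continuous functions on the closed cube that vanish at `0` and are positive elsewhere. -/
structure IsPositiveDefinite {n : ℕ} (φ : State n → ℝ) : Prop where
  continuousOn : ContinuousOn φ (closure (cube n))
  map_zero : φ 0 = 0
  pos : ∀ x ∈ closure (cube n), x ≠ 0 → 0 < φ x

/-- Maximal Lyapunov functions: Lyapunov functions that solve Zubov's equation on the cube for some
positive definite `φ`. -/
def IsMaximalLyapunovFunction {n : ℕ} (f : State n → State n) (V : State n → ℝ) : Prop :=
  IsLyapunovFunction f V ∧
    ∃ φ : State n → ℝ, IsPositiveDefinite φ ∧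
      ∀ x ∈ cube n, fderiv ℝ V x (f x) = -φ x * (1 - V x)

/-- `f x = A x + o(‖x‖)` at the origin, all eigenvalues of `A` having negative real part. -/
def HasStableLinearization {n : ℕ} (f : State n → State n) (A : Matrix (Fin n) (Fin n) ℝ) : Prop :=
  ((fun x : State n => f x - WithLp.toLp 2 (A *ᵥ x.ofLp)) =o[𝓝 0] fun x => x) ∧
    ∀ z ∈ spectrum ℂ (A.map (algebraMap ℝ ℂ)), z.re < 0

/-- A nonconstant smooth activation function, bounded together with its derivatives up to
order three. -/
structure IsActivation (ψ : ℝ → ℝ) : Prop where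
  smooth : ContDiff ℝ (⊤ : ℕ∞) ψ
  bounded : ∀ k ≤ 3, ∃ C : ℝ, ∀ t, |iteratedDeriv k ψ t| ≤ C
  nonconstant : ∃ s t, ψ s ≠ ψ t

/-- The weights and biases of a network with input dimension `n`, `N` neurons per layer and
`n ^ 3` outputs. `W j`, `b j` for `j : Fin L` are the layers `1, …, L`. -/
structure Parameters (n N L : ℕ) where
  W₀ : Matrix (Fin N) (Fin n) ℝ
  b₀ : Fin N → ℝ
  W : Fin L → Matrix (Fin N) (Fin N) ℝ
  b : Fin L → Fin N → ℝ
  Wout : Matrix (Fin (n ^ 3)) (Fin N) ℝ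
  bout : Fin (n ^ 3) → ℝ

/-- The layer map `x ↦ ψ.(W x + b)`. -/
def layer (ψ : ℝ → ℝ) {m N : ℕ} (W : Matrix (Fin N) (Fin m) ℝ) (b : Fin N → ℝ) (x : Fin m → ℝ) :
    Fin N → ℝ :=
  fun j => ψ ((W *ᵥ x + b) j)

/-- The value at `x` of the first layers `0, …, k` of the network. -/
def hidden (ψ : ℝ → ℝ) {n N L : ℕ} (Θ : Parameters n N L) (x : State n) (k : Fin (L + 1)) :
    Fin N → ℝ :=
  Fin.induction (motive := fun _ => Fin N → ℝ) (layer ψ Θ.W₀ Θ.b₀ x.ofLp)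
    (fun j h => layer ψ (Θ.W j) (Θ.b j) h) k

/-- The neural network residual. -/
def residual (ψ : ℝ → ℝ) {n N L : ℕ} (Θ : Parameters n N L) (x : State n) : Fin (n ^ 3) → ℝ :=
  Θ.Wout *ᵥ hidden ψ Θ x (Fin.last L) + Θ.bout

/-- The multi-indices in `{0, 1, 2, 3}ⁿ` of total degree three. -/
abbrev CubicIndex (n : ℕ) : Type := {i : Fin n → Fin 4 // ∑ k, (i k : ℕ) = 3}

/-- The Taylor-neural function; the outputs of the network are selected by the vectors `e i`. -/
noncomputable def taylorNeural (ψ : ℝ → ℝ) {n N L : ℕ} (e : CubicIndex n → Fin (n ^ 3) → ℝ)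
    (P : Matrix (Fin n) (Fin n) ℝ) (Θ : Parameters n N L) (x : State n) : ℝ :=
  1 / 2 * (x.ofLp ⬝ᵥ (P *ᵥ x.ofLp)) +
    ∑ i : CubicIndex n, (residual ψ Θ x ⬝ᵥ e i) * ∏ k, x k ^ (i.1 k : ℕ)

end TaylorNeural

/-!
# Taylor-neural functions approximate maximal Lyapunov functions

A maximal Lyapunov function `V*` is only `C¹` in the open cube `D`, only continuous on its closure,
and need not be comparable to a quadratic form at the origin. It is modified in three steps.

*A smooth Lyapunov function of Taylor type.* For a small level `a > 0` the function
`v = max (V* - a) 0 ²` vanishes near the origin only, because `V*` is continuous and, away from the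
origin, bounded below by a positive constant on the closed cube; at the boundary this uses that a
trajectory starting at a point where `f` points inward enters `D`
(`IsMaximalLyapunovFunction.pos_of_mem_closure`). By Zubov's equation
the derivative of `v` along `f` extends continuously to the closed cube. Hence `v` is the uniform
limit on the closed cube of smooth functions `U` whose derivatives along `f` converge uniformly as
well (`exists_smooth_approx`): contracting towards the origin makes room for a mollification, and
Friedrichs' commutator estimate uses only that `f` is Lipschitz, not that `∇v` is bounded. A small
multiple `½ xᵀ P x` of a quadratic Lyapunov function of the linearization
(`exists_lyapunov_matrix`) supplies positivity and decrease near the origin, where `U` vanishes.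
Rescaling a level of `½ xᵀ P x + U x` between the values of `v` for `V* = 1 - ε` and for `V* = 1`
to the value `1` gives a Lyapunov function with the required basin. All its properties hold with a
margin, so that they survive perturbations `E` with `|E x|` and `‖∇E x‖` at most `κ ‖x‖²` for some
`κ > 0` (`exists_robust_lyapunov`).

*Networks with one hidden layer.* Since `U` vanishes near the origin, it is a combination
`∑ r_i m_i` of the cubic monomials with smooth compactly supported coefficients
(`exists_cubic_coefficients`). If networks approximate the `r_i` in `C¹` on the closed cube, then
the error they cause in `U` is of the form admitted for `E`, because `m_i` and its gradient are
`O(‖x‖²)`. The closure in `C¹` of the span of the neurons `Ψ (⟪w, x⟫ + b)` contains their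
derivatives with respect to the weights, hence all ridge polynomials, hence all `C¹` ridge functions
by Weierstrass' theorem, hence by Fourier inversion all smooth compactly supported functions
(`jet_mem_neuronSpan`). This needs that no derivative of `Ψ` vanishes identically, which holds for
nonconstant bounded `Ψ`.

*Deep networks.* If every hidden layer after the first applies `t ↦ ψ (s t + β)` to each neuron
separately, the deep network is a network with one hidden layer whose activation function is an
iterated composition. For suitable `s` and `β` two distinct values of `ψ` are kept through all
layers, so this composition is not constant (`exists_deepActivation_nonconstant`), and it is smooth
and bounded because `ψ` is. Linear independence of the vectors `e i` allows one output layer to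
realize all coefficients at once (`exists_parameters`).
-/

namespace TaylorNeural

open Set Filter Metric

variable {n : ℕ}

/-! ### The cube -/

lemma isOpen_cube : IsOpen (cube n) := by
  have : cube n = ⋂ k, {x : State n | x k ∈ Ioo (-1 : ℝ) 1} := by
    ext x; simp [cube]
  rw [this]
  exact isOpen_iInter_of_finite fun k => isOpen_Ioo.preimage (by fun_prop)

lemma zero_mem_cube : (0 : State n) ∈ cube n := fun k => by simp

lemma smul_mem_cube {x : State n} (hx : ∀ k, |x k| ≤ 1) {s : ℝ} (hs₀ : 0 ≤ s) (hs₁ : s < 1) :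
    s • x ∈ cube n := by
  intro k
  have h : |s * x k| < 1 := by
    rw [abs_mul, abs_of_nonneg hs₀]
    nlinarith [hx k, abs_nonneg (x k)]
  simpa using abs_lt.1 h

lemma mem_closure_cube {x : State n} : x ∈ closure (cube n) ↔ ∀ k, |x k| ≤ 1 := by
  constructor
  · intro hx k
    have hc : IsClosed {x : State n | |x k| ≤ 1} := isClosed_le (by fun_prop) continuous_const
    have hs : cube n ⊆ {x : State n | |x k| ≤ 1} := fun y hy => (abs_lt.2 (hy k)).le
    exact closure_minimal hs hc hx
  · intro hx
    have ht : Tendsto (fun s : ℝ => s • x) (𝓝[<] 1) (𝓝 x) := by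
      have : Continuous fun s : ℝ => s • x := by fun_prop
      simpa using (this.tendsto 1).mono_left nhdsWithin_le_nhds
    refine mem_closure_of_tendsto ht ?_
    filter_upwards [Ioo_mem_nhdsLT (zero_lt_one' ℝ)] with s hs
    exact smul_mem_cube hx hs.1.le hs.2

lemma norm_le_of_mem_closure_cube {x : State n} (hx : x ∈ closure (cube n)) : ‖x‖ ≤ √n := by
  rw [EuclideanSpace.norm_eq]
  refine Real.sqrt_le_sqrt ?_
  calc ∑ k, ‖x k‖ ^ 2 ≤ ∑ _k : Fin n, (1 : ℝ) := by
        refine Finset.sum_le_sum fun k _ => ?_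
        have := mem_closure_cube.1 hx k
        rw [Real.norm_eq_abs]
        nlinarith [abs_nonneg (x k)]
    _ = n := by simp

lemma isCompact_closure_cube : IsCompact (closure (cube n)) :=
  (isCompact_closedBall (0 : State n) (√n)).of_isClosed_subset isClosed_closure
    fun x hx => by simpa using norm_le_of_mem_closure_cube hx

lemma mem_frontier_cube {x : State n} :
    x ∈ frontier (cube n) ↔ x ∈ closure (cube n) ∧ x ∉ cube n := by
  rw [frontier, isOpen_cube.interior_eq]; rfl

lemma isOutgoingNormal_single {x : State n} {k : Fin n} (hk : x k = 1) :
    IsOutgoingNormal x (EuclideanSpace.single k 1) := by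
  refine ⟨fun h => by simpa using congrArg (fun v : State n => v k) h, fun y hy => ?_⟩
  have := (hy k).2
  simp [EuclideanSpace.inner_single_left, hk]; linarith

lemma isOutgoingNormal_neg_single {x : State n} {k : Fin n} (hk : x k = -1) :
    IsOutgoingNormal x (-EuclideanSpace.single k 1) := by
  refine ⟨fun h => by simpa using congrArg (fun v : State n => v k) h, fun y hy => ?_⟩
  have := (hy k).1
  simp [EuclideanSpace.inner_single_left, hk]; linarith

/-- Short trajectories of an autonomous Lipschitz vector field. -/
lemma exists_trajectory {f : State n → State n} {K : NNReal} (hf : LipschitzWith K f)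
    (p : State n) :
    ∃ T > 0, ∃ γ : ℝ → State n, γ 0 = p ∧ ContinuousOn γ (Icc 0 T) ∧
      HasDerivWithinAt γ (f p) (Ici 0) 0 ∧ ∀ t ∈ Ioo 0 T, HasDerivAt γ (f (γ t)) t := by
  set C : NNReal := ‖f p‖₊ + K + 1
  have hC : (0 : ℝ) < C := by positivity
  have hC' : (C : ℝ) = ‖f p‖ + K + 1 := by simp [C]
  set T : ℝ := 1 / C
  have hT : 0 < T := by positivity
  have hpl : IsPicardLindelof (fun _ => f) (⟨0, by constructor <;> linarith⟩ : Icc (-T) T) p 1 0 C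
      K := by
    refine IsPicardLindelof.of_time_independent (fun x hx => ?_) (hf.lipschitzOnWith) ?_
    · have h1 := hf.norm_sub_le x p
      have h2 : ‖x - p‖ ≤ 1 := by simpa [dist_eq_norm] using hx
      have h3 : ‖f x‖ ≤ ‖f x - f p‖ + ‖f p‖ := by
        simpa using norm_add_le (f x - f p) (f p)
      rw [hC']
      nlinarith [K.2, norm_nonneg (x - p), mul_le_mul_of_nonneg_left h2 K.2]
    · simp [T, hC.ne']
  obtain ⟨γ, h0, hγ⟩ := hpl.exists_eq_forall_mem_Icc_hasDerivWithinAt (x := p) (by simp)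
  simp only at h0
  have hd : ∀ t ∈ Ioo (-T) T, HasDerivAt γ (f (γ t)) t := fun t ht =>
    (hγ t (Ioo_subset_Icc_self ht)).hasDerivAt (Icc_mem_nhds ht.1 ht.2)
  refine ⟨T, hT, γ, h0, fun t ht => ?_, ?_, fun t ht => hd t ⟨by linarith [ht.1], ht.2⟩⟩
  · exact ((hγ t ⟨by linarith [ht.1], ht.2⟩).continuousWithinAt).mono
      (Icc_subset_Icc_left (by linarith))
  · simpa [h0] using (hd 0 ⟨by linarith, hT⟩).hasDerivWithinAt (s := Ici 0)

/-- A trajectory that starts at a boundary point where the vector field points strictly inward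
enters the cube at once. -/
lemma eventually_mem_cube {f : State n → State n} {p : State n} (hp : p ∈ closure (cube n))
    (hin : ∀ ν, IsOutgoingNormal p ν → inner ℝ (f p) ν < 0) {γ : ℝ → State n} (h0 : γ 0 = p)
    (hγ : HasDerivWithinAt γ (f p) (Ici 0) 0) : ∀ᶠ t in 𝓝[>] 0, γ t ∈ cube n := by
  have hk : ∀ k, HasDerivWithinAt (fun t => γ t k) (f p k) (Ici 0) 0 := fun k =>
    (EuclideanSpace.proj (𝕜 := ℝ) k).hasFDerivAt.comp_hasDerivWithinAt (0 : ℝ) hγ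
  have hkc : ∀ k, Tendsto (fun t => γ t k) (𝓝[>] 0) (𝓝 (p k)) := fun k => by
    have := (hk k).continuousWithinAt.tendsto
    simp only [h0] at this
    exact this.mono_left (nhdsWithin_mono _ Ioi_subset_Ici_self)
  have hslope : ∀ k, Tendsto (slope (fun t => γ t k) 0) (𝓝[>] 0) (𝓝 (f p k)) := fun k =>
    (hasDerivWithinAt_iff_tendsto_slope.1 (hk k)).mono_left
      (nhdsWithin_mono _ fun t (ht : 0 < t) => ⟨ht.le, ht.ne'⟩)
  have hpk := mem_closure_cube.1 hp
  have key : ∀ k, ∀ᶠ t in 𝓝[>] 0, γ t k ∈ Ioo (-1 : ℝ) 1 := by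
    intro k
    have hup : ∀ᶠ t in 𝓝[>] 0, γ t k < 1 := by
      rcases (abs_le.1 (hpk k)).2.lt_or_eq with h | h
      · exact (hkc k).eventually (gt_mem_nhds h)
      · have hfk : f p k < 0 := by
          simpa [EuclideanSpace.inner_single_right] using hin _ (isOutgoingNormal_single h)
        filter_upwards [(hslope k).eventually (gt_mem_nhds hfk), self_mem_nhdsWithin]
          with t ht (ht0 : 0 < t)
        rw [slope_def_field, h0, h, sub_zero, div_neg_iff] at ht
        rcases ht with ht | ht <;> linarith
    have hlo : ∀ᶠ t in 𝓝[>] 0, -1 < γ t k := by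
      rcases (abs_le.1 (hpk k)).1.lt_or_eq with h | h
      · exact (hkc k).eventually (lt_mem_nhds h)
      · have hfk : 0 < f p k := by
          simpa [EuclideanSpace.inner_single_right] using
            hin _ (isOutgoingNormal_neg_single h.symm)
        filter_upwards [(hslope k).eventually (lt_mem_nhds hfk), self_mem_nhdsWithin]
          with t ht (ht0 : 0 < t)
        rw [slope_def_field, h0, ← h, sub_zero, div_pos_iff] at ht
        rcases ht with ht | ht <;> linarith
    filter_upwards [hup, hlo] with t h1 h2 using ⟨h2, h1⟩
  filter_upwards [eventually_all.2 key] with t ht using ht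

/-- A Lyapunov function that solves Zubov's equation is positive on the closed cube, except at the
origin: at a boundary point with value at most `0` the vector field points inward, so the
trajectory enters the cube and the values would become negative there. -/
lemma IsMaximalLyapunovFunction.pos_of_mem_closure {f : State n → State n} {K : NNReal}
    (hf : LipschitzWith K f) {V : State n → ℝ} (hV : IsMaximalLyapunovFunction f V)
    {p : State n} (hp : p ∈ closure (cube n)) (hp0 : p ≠ 0) : 0 < V p := by
  by_cases hpc : p ∈ cube n
  · exact hV.1.pos p hpc hp0
  by_contra! hneg
  have hin : ∀ ν, IsOutgoingNormal p ν → inner ℝ (f p) ν < 0 := by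
    intro ν hν
    by_contra! h
    linarith [hV.1.boundary p (mem_frontier_cube.2 ⟨hp, hpc⟩) ν hν h]
  obtain ⟨T, hT, γ, h0, hγc, hγ0, hγd⟩ := exists_trajectory hf p
  have hev := eventually_mem_cube hp hin h0 hγ0
  have hne : ∀ᶠ t in 𝓝[>] 0, γ t ≠ 0 := by
    have : Tendsto γ (𝓝[>] 0) (𝓝 p) := by
      have := hγ0.continuousWithinAt.tendsto
      rw [h0] at this
      exact this.mono_left (nhdsWithin_mono _ Ioi_subset_Ici_self)
    exact this.eventually_ne hp0
  obtain ⟨u, hu, hsub⟩ := mem_nhdsGT_iff_exists_Ioo_subset.1 (hev.and hne)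
  have hu : 0 < u := hu
  set s := min u T / 2
  have hs : 0 < s := by have := lt_min hu hT; positivity
  have hsu : s < u := by have := min_le_left u T; simp only [s]; linarith [lt_min hu hT]
  have hsT : s < T := by have := min_le_right u T; simp only [s]; linarith [lt_min hu hT]
  have hmem : ∀ t ∈ Icc 0 s, γ t ∈ closure (cube n) := by
    intro t ht
    rcases ht.1.eq_or_lt with h | h
    · rw [← h, h0]; exact hp
    · exact subset_closure (hsub ⟨h, by linarith [ht.2]⟩).1
  have hcont : ContinuousOn (fun t => V (γ t)) (Icc 0 s) :=
    hV.1.continuousOn.comp (hγc.mono (Icc_subset_Icc_right hsT.le)) hmem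
  obtain ⟨φ, hφ, hz⟩ := hV.2
  have hder : ∀ t ∈ Ioo 0 s, HasDerivAt (fun t => V (γ t)) (-φ (γ t) * (1 - V (γ t))) t := by
    intro t ht
    have hc := (hsub ⟨ht.1, by linarith [ht.2]⟩).1
    have hVd : DifferentiableAt ℝ V (γ t) :=
      (hV.1.contDiffOn.differentiableOn one_ne_zero).differentiableAt (isOpen_cube.mem_nhds hc)
    rw [← hz _ hc]
    exact hVd.hasFDerivAt.comp_hasDerivAt t (hγd t ⟨ht.1, by linarith [ht.2]⟩)
  -- Shorten the interval so that `V < 1` along the trajectory.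
  have hlt : ∀ᶠ t in 𝓝[>] 0, V (γ t) < 1 := by
    have h1 : Tendsto (fun t => V (γ t)) (𝓝[>] 0) (𝓝 (V p)) := by
      have := (hcont 0 ⟨le_rfl, hs.le⟩).tendsto
      rw [h0] at this
      refine this.mono_left ?_
      rw [← nhdsWithin_Ioo_eq_nhdsGT hs]
      exact nhdsWithin_mono _ Ioo_subset_Icc_self
    exact h1.eventually (gt_mem_nhds (by linarith))
  obtain ⟨u', hu', hsub'⟩ := mem_nhdsGT_iff_exists_Ioo_subset.1 hlt
  have hu' : 0 < u' := hu'
  set r := min u' s / 2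
  have hr : 0 < r := by have := lt_min hu' hs; positivity
  have hru : r < u' := by have := min_le_left u' s; simp only [r]; linarith [lt_min hu' hs]
  have hrs : r < s := by have := min_le_right u' s; simp only [r]; linarith [lt_min hu' hs]
  have hanti : AntitoneOn (fun t => V (γ t)) (Icc 0 r) := by
    refine antitoneOn_of_deriv_nonpos (convex_Icc 0 r)
      (hcont.mono (Icc_subset_Icc_right hrs.le)) ?_ ?_
    · rw [interior_Icc]
      exact fun t ht =>
        (hder t ⟨ht.1, by linarith [ht.2]⟩).differentiableAt.differentiableWithinAt
    · rw [interior_Icc]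
      intro t ht
      rw [(hder t ⟨ht.1, by linarith [ht.2]⟩).deriv]
      have h1 : V (γ t) < 1 := hsub' ⟨ht.1, by linarith [ht.2]⟩
      have h2 := hsub ⟨ht.1, by linarith [ht.2]⟩
      have h3 := hφ.pos _ (subset_closure h2.1) h2.2
      nlinarith
  have hend := hanti ⟨le_rfl, hr.le⟩ ⟨hr.le, le_rfl⟩ hr.le
  simp only [h0] at hend
  have h2 := hsub ⟨hr, by linarith⟩
  linarith [hV.1.pos _ h2.1 h2.2]

/-! ### The Lyapunov inequality for a stable matrix -/

open scoped Matrix.Norms.L2Operator in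
/-- If all eigenvalues of `A` have negative real part, then a power of the Euler step `1 + h A` is
a contraction for the Euclidean norm: for small `h` the eigenvalues `1 + h z` lie in the open unit
disc, and Gelfand's formula applies. -/
lemma exists_contracting_pow {A : Matrix (Fin n) (Fin n) ℝ}
    (hA : ∀ z ∈ spectrum ℂ (A.map (algebraMap ℝ ℂ)), z.re < 0) (hn : 0 < n) :
    ∃ h > (0 : ℝ), ∃ m : ℕ, 0 < m ∧ ∃ q < (1 : ℝ), ∀ x : Fin n → ℝ,
      ((1 + h • A) ^ m *ᵥ x) ⬝ᵥ ((1 + h • A) ^ m *ᵥ x) ≤ q * (x ⬝ᵥ x) := by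
  have : Nonempty (Fin n) := ⟨⟨0, hn⟩⟩
  set B : Matrix (Fin n) (Fin n) ℂ := A.map (algebraMap ℝ ℂ)
  have hev : ∀ᶠ h : ℝ in 𝓝[>] 0, ∀ z ∈ spectrum ℂ B, ‖1 + (h : ℂ) * z‖ < 1 := by
    rw [eventually_all_finite (Matrix.finite_spectrum B)]
    intro z hz
    have hlim : Tendsto (fun h : ℝ => 2 * z.re + h * Complex.normSq z) (𝓝[>] 0)
        (𝓝 (2 * z.re)) := by
      have : Continuous fun h : ℝ => 2 * z.re + h * Complex.normSq z := by fun_prop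
      simpa using (this.tendsto 0).mono_left nhdsWithin_le_nhds
    filter_upwards [hlim.eventually (gt_mem_nhds (show 2 * z.re < 0 by linarith [hA z hz])),
      self_mem_nhdsWithin] with h hh (h0 : 0 < h)
    rw [← sq_lt_one_iff₀ (norm_nonneg _), ← Complex.normSq_eq_norm_sq]
    have : Complex.normSq (1 + (h : ℂ) * z) = 1 + h * (2 * z.re + h * Complex.normSq z) := by
      simp only [Complex.normSq_apply, Complex.add_re, Complex.one_re, Complex.mul_re,
        Complex.ofReal_re, Complex.ofReal_im, zero_mul, sub_zero, Complex.add_im, Complex.one_im,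
        Complex.mul_im, add_zero, zero_add]
      ring
    rw [this]
    nlinarith
  obtain ⟨h, hspec, h0 : 0 < h⟩ := (hev.and self_mem_nhdsWithin).exists
  set M : Matrix (Fin n) (Fin n) ℂ := 1 + (h : ℂ) • B
  have hM : M = (1 + h • A).map (algebraMap ℝ ℂ) := by
    ext i j
    by_cases hij : i = j <;> simp [M, B, hij]
  have hrad : spectralRadius ℂ M < (1 : NNReal) := by
    refine spectrum.spectralRadius_lt_of_forall_lt _ fun w hw => ?_
    have h1 : M = algebraMap ℂ _ 1 + (h : ℂ) • B := by simp [M]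
    rw [h1, ← spectrum.singleton_add_eq,
      spectrum.smul_eq_smul _ _ (spectrum.nonempty B)] at hw
    obtain ⟨_, rfl, _, ⟨z, hz, rfl⟩, rfl⟩ := hw
    exact_mod_cast hspec z hz
  have hlim := spectrum.pow_nnnorm_pow_one_div_tendsto_nhds_spectralRadius M
  obtain ⟨m, hm, hm0⟩ := ((hlim.eventually (gt_mem_nhds hrad)).and (eventually_gt_atTop 0)).exists
  have hlt : ‖M ^ m‖ < 1 := by
    by_contra! hge
    have : (1 : ENNReal) ≤ (‖M ^ m‖₊ : ENNReal) ^ (1 / (m : ℝ)) := by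
      refine ENNReal.one_le_rpow ?_ (by positivity)
      exact_mod_cast hge
    exact absurd hm (not_lt.2 (by simpa using this))
  refine ⟨h, h0, m, hm0, ‖M ^ m‖ ^ 2, by nlinarith [norm_nonneg (M ^ m)], fun x => ?_⟩
  have key := Matrix.l2_opNorm_mulVec (M ^ m) (WithLp.toLp 2 fun i => (x i : ℂ))
  have hnorm : ∀ y : Fin n → ℝ, ‖(WithLp.toLp 2 fun i => (y i : ℂ) : EuclideanSpace ℂ (Fin n))‖ ^ 2
      = y ⬝ᵥ y := by
    intro y
    rw [EuclideanSpace.norm_sq_eq]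
    simp [dotProduct, sq]
  have hpow : M ^ m = ((1 + h • A) ^ m).map (algebraMap ℝ ℂ) := by
    rw [hM, Matrix.map_pow]
  have hmul : (M ^ m) *ᵥ (fun i => (x i : ℂ)) = fun i => (((1 + h • A) ^ m *ᵥ x) i : ℂ) := by
    rw [hpow]
    ext i
    simp [Matrix.mulVec, dotProduct]
  rw [← hnorm, ← hnorm x, ← mul_pow]
  refine pow_le_pow_left₀ (norm_nonneg _) ?_ 2
  simpa [hmul] using key

/-- A matrix all of whose eigenvalues have negative real part admits a quadratic Lyapunov function.
It is the truncated Gramian `∑ k < m, (Mᵀ)ᵏ Mᵏ` of an Euler step `M = 1 + h A` such that `Mᵐ` is a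
contraction: `Mᵀ P M - P = (Mᵀ)ᵐ Mᵐ - 1` is negative definite, and it equals
`h (Aᵀ P + P A) + h² Aᵀ P A`. -/
lemma exists_lyapunov_matrix {A : Matrix (Fin n) (Fin n) ℝ}
    (hA : ∀ z ∈ spectrum ℂ (A.map (algebraMap ℝ ℂ)), z.re < 0) (hn : 0 < n) :
    ∃ P : Matrix (Fin n) (Fin n) ℝ, Pᵀ = P ∧ (∀ x, x ⬝ᵥ x ≤ x ⬝ᵥ (P *ᵥ x)) ∧
      ∃ c > 0, ∀ x, x ⬝ᵥ ((Aᵀ * P + P * A) *ᵥ x) ≤ -c * (x ⬝ᵥ x) := by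
  obtain ⟨h, h0, m, hm, q, hq, hcon⟩ := exists_contracting_pow hA hn
  set M := 1 + h • A
  set P := ∑ k ∈ Finset.range m, (Mᵀ) ^ k * M ^ k
  have hquad : ∀ (k : ℕ) (x : Fin n → ℝ),
      x ⬝ᵥ (((Mᵀ) ^ k * M ^ k) *ᵥ x) = (M ^ k *ᵥ x) ⬝ᵥ (M ^ k *ᵥ x) := by
    intro k x
    rw [← Matrix.mulVec_mulVec, Matrix.dotProduct_mulVec, ← Matrix.transpose_pow,
      Matrix.vecMul_transpose]
  have hPx : ∀ x, x ⬝ᵥ (P *ᵥ x) = ∑ k ∈ Finset.range m, (M ^ k *ᵥ x) ⬝ᵥ (M ^ k *ᵥ x) := by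
    intro x
    simp only [P, Matrix.sum_mulVec, dotProduct_sum, hquad]
  have hnn : ∀ y : Fin n → ℝ, 0 ≤ y ⬝ᵥ y := fun y =>
    Finset.sum_nonneg fun i _ => mul_self_nonneg _
  have hP1 : ∀ x, x ⬝ᵥ x ≤ x ⬝ᵥ (P *ᵥ x) := by
    intro x
    rw [hPx]
    have := Finset.single_le_sum (f := fun k => (M ^ k *ᵥ x) ⬝ᵥ (M ^ k *ᵥ x))
      (fun k _ => hnn _) (Finset.mem_range.2 hm)
    simpa using this
  have htel : Mᵀ * P * M - P = (Mᵀ) ^ m * M ^ m - 1 := by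
    have := Finset.sum_range_sub (fun k => (Mᵀ) ^ k * M ^ k) m
    simp only [pow_zero, mul_one] at this
    rw [← this, Finset.sum_sub_distrib]
    congr 1
    simp only [P, Finset.mul_sum, Finset.sum_mul]
    refine Finset.sum_congr rfl fun k _ => ?_
    rw [pow_succ' (Mᵀ), pow_succ M]
    simp only [mul_assoc]
  have hexp : Mᵀ * P * M - P = h • (Aᵀ * P + P * A) + (h * h) • (Aᵀ * P * A) := by
    simp only [M, Matrix.transpose_add, Matrix.transpose_one, Matrix.transpose_smul, add_mul,
      mul_add, one_mul, mul_one, Matrix.smul_mul, Matrix.mul_smul, smul_add, smul_smul, mul_assoc]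
    abel
  refine ⟨P, ?_, hP1, (1 - q) / h, div_pos (by linarith) h0, fun x => ?_⟩
  · simp only [P, Matrix.transpose_sum, Matrix.transpose_mul, Matrix.transpose_pow,
      Matrix.transpose_transpose]
  have h1 : x ⬝ᵥ ((h • (Aᵀ * P + P * A) + (h * h) • (Aᵀ * P * A)) *ᵥ x)
      = (M ^ m *ᵥ x) ⬝ᵥ (M ^ m *ᵥ x) - x ⬝ᵥ x := by
    rw [← hexp, htel, Matrix.sub_mulVec, dotProduct_sub, hquad, Matrix.one_mulVec]
  have h2 : x ⬝ᵥ ((Aᵀ * P * A) *ᵥ x) = (A *ᵥ x) ⬝ᵥ (P *ᵥ (A *ᵥ x)) := by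
    rw [mul_assoc, ← Matrix.mulVec_mulVec, Matrix.dotProduct_mulVec, Matrix.vecMul_transpose,
      Matrix.mulVec_mulVec]
  rw [Matrix.add_mulVec, Matrix.smul_mulVec, Matrix.smul_mulVec, dotProduct_add, dotProduct_smul,
    dotProduct_smul, h2, smul_eq_mul, smul_eq_mul] at h1
  have h3 := (hnn (A *ᵥ x)).trans (hP1 (A *ᵥ x))
  have h4 := hcon x
  have h5 : h * (x ⬝ᵥ ((Aᵀ * P + P * A) *ᵥ x)) ≤ -(1 - q) * (x ⬝ᵥ x) := by
    nlinarith [mul_nonneg (mul_pos h0 h0).le h3]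
  have : -((1 - q) / h) * (x ⬝ᵥ x) = (-(1 - q) * (x ⬝ᵥ x)) / h := by ring
  rw [this, le_div_iff₀ h0]
  linarith

/-! ### Smoothing along a Lipschitz vector field -/

open MeasureTheory
open scoped ContDiff Manifold

lemma exists_smooth_cutoff {s C : Set (State n)} (hs : IsOpen s) (hC : IsCompact C)
    (hCs : C ⊆ s) :
    ∃ χ : State n → ℝ, ContDiff ℝ ∞ χ ∧ HasCompactSupport χ ∧ tsupport χ ⊆ s ∧
      ∀ᶠ x in 𝓝ˢ C, χ x = 1 := by
  obtain ⟨C', hC', hCC', hC's⟩ := exists_compact_between hC hs hCs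
  obtain ⟨χ, h1, h0, -⟩ := exists_contMDiffMap_one_nhds_of_subset_interior (n := (⊤ : ℕ∞))
    𝓘(ℝ, State n) hC.isClosed hCC'
  have hts : tsupport (χ : State n → ℝ) ⊆ C' := by
    refine closure_minimal (fun x hx => ?_) hC'.isClosed
    by_contra h
    exact hx (h0 x h)
  exact ⟨χ, χ.contMDiff.contDiff, hC'.of_isClosed_subset (isClosed_tsupport _) hts,
    hts.trans hC's, h1⟩

/-- A `C¹` function on an open set agrees near a given compact subset with a compactly supported
`C¹` function on the whole space. -/
lemma exists_compactly_supported_extension {s C : Set (State n)} (hs : IsOpen s)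
    (hC : IsCompact C) (hCs : C ⊆ s) {v : State n → ℝ} (hv : ContDiffOn ℝ 1 v s) :
    ∃ w : State n → ℝ, ContDiff ℝ 1 w ∧ HasCompactSupport w ∧ ∀ z ∈ C, w =ᶠ[𝓝 z] v := by
  obtain ⟨χ, hχ, hχc, hχs, hχ1⟩ := exists_smooth_cutoff hs hC hCs
  refine ⟨fun x => χ x * v x, ?_, hχc.mul_right, fun z hz => ?_⟩
  · refine contDiff_iff_contDiffAt.2 fun x => ?_
    by_cases hx : x ∈ s
    · exact (hχ.of_le (by exact_mod_cast le_top)).contDiffAt.mul (hv.contDiffAt (hs.mem_nhds hx))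
    · have : (fun x => χ x * v x) =ᶠ[𝓝 x] fun _ => 0 := by
        have hx' : (tsupport χ)ᶜ ∈ 𝓝 x :=
          (isClosed_tsupport χ).isOpen_compl.mem_nhds fun h => hx (hχs h)
        filter_upwards [hx'] with y hy
        rw [image_eq_zero_of_notMem_tsupport hy, zero_mul]
      exact contDiffAt_const.congr_of_eventuallyEq this
  · filter_upwards [eventually_nhdsSet_iff_forall.1 hχ1 z hz] with y hy
    rw [hy, one_mul]

/-- Mollification by the kernel `τ⁻ⁿ η (· / τ)`, written as an average of translates. -/
lemma mollification {η w : State n → ℝ} (hη : ContDiff ℝ ∞ η) (hηc : HasCompactSupport η)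
    (hw : ContDiff ℝ 1 w) (hwc : HasCompactSupport w) {τ : ℝ} (hτ : 0 < τ) :
    ContDiff ℝ ∞ (fun x => ∫ y, η y * w (x - τ • y)) ∧
      HasCompactSupport (fun x => ∫ y, η y * w (x - τ • y)) ∧
      ∀ x, HasFDerivAt (fun x => ∫ y, η y * w (x - τ • y))
        (∫ y, η y • fderiv ℝ w (x - τ • y)) x := by
  set κ : State n → ℝ := fun t => (τ ^ Module.finrank ℝ (State n))⁻¹ * η (τ⁻¹ • t)
  have hτn : τ ^ Module.finrank ℝ (State n) ≠ 0 := by positivity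
  have hκ : ContDiff ℝ ∞ κ := contDiff_const.mul (hη.comp (contDiff_const_smul _))
  have hκc : HasCompactSupport κ :=
    (hηc.comp_homeomorph (Homeomorph.smulOfNeZero τ⁻¹ (inv_ne_zero hτ.ne'))).mul_left
  have hchange : ∀ {F : Type} [NormedAddCommGroup F] [NormedSpace ℝ F] (h : State n → F)
      (x : State n), ∫ t, κ t • h (x - t) = ∫ y, η y • h (x - τ • y) := by
    intro F _ _ h x
    have := Measure.integral_comp_inv_smul_of_nonneg (volume : Measure (State n))
      (fun y => η y • h (x - τ • y)) hτ.le
    simp only [smul_inv_smul₀ hτ.ne'] at this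
    rw [← inv_smul_eq_iff₀ hτn] at this
    rw [← this, ← integral_smul]
    simp only [κ, smul_smul]
  have hconv : (fun x => ∫ y, η y * w (x - τ • y))
      = MeasureTheory.convolution κ w (ContinuousLinearMap.lsmul ℝ ℝ) volume := by
    ext x
    rw [MeasureTheory.convolution_def]
    simpa using (hchange w x).symm
  have hκl : LocallyIntegrable κ volume := hκ.continuous.locallyIntegrable
  rw [hconv]
  refine ⟨hκc.contDiff_convolution_left _ hκ hw.continuous.locallyIntegrable,
    hκc.convolution _ hwc, fun x => ?_⟩
  convert! hwc.hasFDerivAt_convolution_right (ContinuousLinearMap.lsmul ℝ ℝ) hκl hw x using 1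
  rw [MeasureTheory.convolution_def, ← hchange]
  rfl

/-- The product of a Lipschitz bump with a Lipschitz function that is bounded on the support of
the bump. -/
lemma lipschitzWith_mul_of_support {η F : State n → ℝ} {L K B C : NNReal} (hη : LipschitzWith L η)
    (hηB : ∀ y, |η y| ≤ B) (hη0 : ∀ y, 1 ≤ ‖y‖ → η y = 0) (hF : LipschitzWith K F)
    (hFC : ∀ y, ‖y‖ ≤ 1 → |F y| ≤ C) : LipschitzWith (L * C + B * K) fun y => η y * F y := by
  have key : ∀ y z, ‖z‖ ≤ 1 → |η y * F y - η z * F z| ≤ (L * C + B * K) * dist y z := by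
    intro y z hz
    have h1 : η y * F y - η z * F z = η y * (F y - F z) + (η y - η z) * F z := by ring
    have h2 := hη.dist_le_mul y z
    have h3 := hF.dist_le_mul y z
    rw [Real.dist_eq] at h2 h3
    calc |η y * F y - η z * F z| ≤ |η y| * |F y - F z| + |η y - η z| * |F z| := by
          rw [h1, ← abs_mul, ← abs_mul]; exact abs_add_le _ _
      _ ≤ B * (K * dist y z) + (L * dist y z) * C := by
          gcongr
          · exact hηB y
          · exact hFC z hz
      _ = (L * C + B * K) * dist y z := by ring
  refine LipschitzWith.of_dist_le_mul fun y z => ?_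
  rw [Real.dist_eq]
  push_cast
  by_cases hz : ‖z‖ ≤ 1
  · exact key y z hz
  by_cases hy : ‖y‖ ≤ 1
  · rw [abs_sub_comm, dist_comm]; exact key z y hy
  · rw [hη0 y (not_le.1 hy).le, hη0 z (not_le.1 hz).le]
    simp; positivity

/-- Integration by parts bounds the integral of a derivative of `u` against a Lipschitz function
supported in the unit ball by the oscillation of `u` there. -/
lemma abs_integral_lineDeriv_mul_le {G u : State n → ℝ} {D E : NNReal} (hG : LipschitzWith D G)
    (hG0 : ∀ y, 1 ≤ ‖y‖ → G y = 0) (hu : LipschitzWith E u) {c θ : ℝ}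
    (huc : ∀ y, ‖y‖ ≤ 1 → |u y - c| ≤ θ) (w : State n) :
    |∫ y, lineDeriv ℝ u y w * G y|
      ≤ D * ‖w‖ * θ * (volume : Measure (State n)).real (closedBall 0 1) := by
  have hGc : HasCompactSupport G := by
    refine HasCompactSupport.intro (isCompact_closedBall (0 : State n) 1) fun y hy => hG0 y ?_
    simpa using (not_le.1 fun h => hy (by simpa using h)).le
  have hu' : LipschitzWith E fun y => u y - c :=
    LipschitzWith.of_dist_le_mul fun y z => by simpa using hu.dist_le_mul y z
  have hline : ∀ y, lineDeriv ℝ (fun y => u y - c) y w = lineDeriv ℝ u y w := fun y => by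
    simp [lineDeriv]
  have hparts := hu'.integral_lineDeriv_mul_eq (μ := volume) hG hGc w
  simp only [hline] at hparts
  rw [hparts, ← setIntegral_eq_integral_of_forall_compl_eq_zero (s := closedBall 0 1),
    ← Real.norm_eq_abs]
  · refine norm_setIntegral_le_of_norm_le_const measure_closedBall_lt_top fun y hy => ?_
    rw [norm_mul, Real.norm_eq_abs (u y - c)]
    refine mul_le_mul ?_ (huc y (by simpa using hy)) (abs_nonneg _) (by positivity)
    simpa using norm_lineDeriv_le_of_lipschitz ℝ hG (v := -w) (x₀ := y)
  · intro y hy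
    have hev : G =ᶠ[𝓝 y] fun _ => 0 := by
      filter_upwards [isClosed_closedBall.isOpen_compl.mem_nhds hy] with z hz
      exact hG0 z (by simpa using (not_le.1 fun h => hz (by simpa using h)).le)
    rw [hev.lineDeriv_eq]
    simp [lineDeriv]

/-- Friedrichs' commutator estimate. The derivative of `w` along the difference between the vector
field at `x` and at the point `(1 - 2τ) x - τ y` averages to a quantity controlled by the
oscillation of `w` alone: integrating by parts moves the derivative to the difference, which is
Lipschitz in `y` with a constant of order `τ`. -/
lemma abs_integral_commutator_le {f : State n → State n} {K : NNReal} (hf : LipschitzWith K f)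
    (hf₀ : f 0 = 0) {η : State n → ℝ} {Λ B : NNReal} (hη : LipschitzWith Λ η)
    (hηB : ∀ y, |η y| ≤ B) (hη0 : ∀ y, 1 ≤ ‖y‖ → η y = 0) {w : State n → ℝ}
    (hw : ContDiff ℝ 1 w) (hwc : HasCompactSupport w) {τ : ℝ} (hτ : 0 < τ) {R : NNReal}
    {x : State n} (hx : ‖x‖ ≤ R) {c θ : ℝ}
    (hθ : ∀ y, ‖y‖ ≤ 1 → |w ((1 - 2 * τ) • x - τ • y) - c| ≤ θ) :
    |∫ y, η y * fderiv ℝ w ((1 - 2 * τ) • x - τ • y)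
        ((1 - 2 * τ) • f x - f ((1 - 2 * τ) • x - τ • y))|
      ≤ n * ((Λ * (K * (4 * R + 1)) + B * K) * θ
        * (volume : Measure (State n)).real (closedBall 0 1)) := by
  set z : State n → State n := fun y => (1 - 2 * τ) • x - τ • y
  have hzc : ContDiff ℝ 1 z := by fun_prop
  have hηcont := hη.continuous
  have hηc : HasCompactSupport η := by
    refine HasCompactSupport.intro (isCompact_closedBall (0 : State n) 1) fun y hy => hη0 y ?_
    simpa using (not_le.1 fun h => hy (by simpa using h)).le
  -- The commutator, coordinatewise and divided by `τ`.
  set F : Fin n → State n → ℝ := fun k y => τ⁻¹ * ((1 - 2 * τ) • f x - f (z y)) k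
  have hzl : ∀ y y', ‖z y - z y'‖ = τ * ‖y - y'‖ := by
    intro y y'
    have : z y - z y' = τ • (y' - y) := by simp only [z]; module
    rw [this, norm_smul, Real.norm_of_nonneg hτ.le, norm_sub_rev]
  have hF : ∀ k, LipschitzWith K (F k) := by
    intro k
    refine LipschitzWith.of_dist_le_mul fun y y' => ?_
    rw [Real.dist_eq, dist_eq_norm]
    have h1 : F k y - F k y' = τ⁻¹ * (f (z y') - f (z y)) k := by simp [F]; ring
    have h2 : |(f (z y') - f (z y)) k| ≤ K * (τ * ‖y - y'‖) := by
      refine (PiLp.norm_apply_le (p := 2) (f (z y') - f (z y)) k).trans ?_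
      refine (hf.norm_sub_le _ _).trans_eq ?_
      rw [hzl, norm_sub_rev]
    rw [h1, abs_mul, abs_of_pos (inv_pos.2 hτ)]
    calc τ⁻¹ * |(f (z y') - f (z y)) k| ≤ τ⁻¹ * (K * (τ * ‖y - y'‖)) := by gcongr
      _ = K * ‖y - y'‖ := by field_simp
  have hFC : ∀ k y, ‖y‖ ≤ 1 → |F k y| ≤ (K * (4 * R + 1) : NNReal) := by
    intro k y hy
    have h0 : (1 - 2 * τ) • f x - f (z y) = (f x - f (z y)) - (2 * τ) • f x := by module
    have h1 : ‖f x‖ ≤ K * R := by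
      have := hf.norm_sub_le x 0
      rw [hf₀, sub_zero, sub_zero] at this
      exact this.trans (by gcongr)
    have h2 : ‖x - z y‖ ≤ 2 * τ * R + τ := by
      have : x - z y = (2 * τ) • x + τ • y := by simp only [z]; module
      rw [this]
      refine (norm_add_le _ _).trans ?_
      rw [norm_smul, norm_smul, Real.norm_of_nonneg hτ.le, Real.norm_of_nonneg (by positivity)]
      exact add_le_add (by gcongr) (by nlinarith)
    have h3 : ‖(1 - 2 * τ) • f x - f (z y)‖ ≤ τ * (K * (4 * R + 1)) := by
      rw [h0]
      refine (norm_sub_le _ _).trans ?_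
      rw [norm_smul, Real.norm_of_nonneg (by positivity)]
      calc ‖f x - f (z y)‖ + 2 * τ * ‖f x‖ ≤ K * (2 * τ * R + τ) + 2 * τ * (K * R) := by
            gcongr
            exact (hf.norm_sub_le _ _).trans (by gcongr)
        _ = τ * (K * (4 * R + 1)) := by ring
    have h4 := (PiLp.norm_apply_le (p := 2) ((1 - 2 * τ) • f x - f (z y)) k).trans h3
    rw [Real.norm_eq_abs] at h4
    simp only [F]
    rw [abs_mul, abs_of_pos (inv_pos.2 hτ), inv_mul_le_iff₀ hτ]
    exact_mod_cast h4
  set u : State n → ℝ := fun y => w (z y)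
  have huc : HasCompactSupport u := by
    have h1 : u = w ∘ ((Homeomorph.smulOfNeZero (-τ) (neg_ne_zero.2 hτ.ne')).trans
        (Homeomorph.addLeft ((1 - 2 * τ) • x))) := by
      ext y; simp [u, z, sub_eq_add_neg]
    rw [h1]
    exact hwc.comp_homeomorph _
  obtain ⟨E, hu⟩ := ContDiff.lipschitzWith_of_hasCompactSupport huc (hw.comp hzc) one_ne_zero
  have hline : ∀ y e, lineDeriv ℝ u y e = -τ * fderiv ℝ w (z y) e := by
    intro y e
    have h1 : HasFDerivAt z (-τ • ContinuousLinearMap.id ℝ (State n)) y := by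
      have := ((hasFDerivAt_id (𝕜 := ℝ) y).const_smul τ).const_sub ((1 - 2 * τ) • x)
      convert! this using 1
      ext v
      simp
    have h2 : HasFDerivAt u _ y :=
      ((hw.differentiable one_ne_zero).differentiableAt.hasFDerivAt).comp y h1
    rw [h2.differentiableAt.lineDeriv_eq_fderiv, h2.fderiv]
    simp
  set b : Fin n → State n := fun k => EuclideanSpace.single k 1
  have hsum : ∀ y, η y * fderiv ℝ w (z y) ((1 - 2 * τ) • f x - f (z y))
      = ∑ k, -(lineDeriv ℝ u y (b k) * (η y * F k y)) := by
    intro y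
    set a := (1 - 2 * τ) • f x - f (z y) with ha
    have h1 : a = ∑ k, a k • b k := by
      have := (EuclideanSpace.basisFun (Fin n) ℝ).sum_repr a
      simpa [b] using this.symm
    conv_lhs => rw [h1]
    rw [map_sum, Finset.mul_sum]
    refine Finset.sum_congr rfl fun k _ => ?_
    rw [hline, map_smul]
    simp only [F, smul_eq_mul]
    rw [← ha]
    field_simp
  have hint : ∀ k, Integrable (fun y => -(lineDeriv ℝ u y (b k) * (η y * F k y))) := by
    intro k
    refine (Continuous.integrable_of_hasCompactSupport ?_ (hηc.mul_right.mul_left)).neg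
    refine Continuous.mul ?_ (hηcont.mul (hF k).continuous)
    simp only [hline]
    exact continuous_const.mul
      (((hw.continuous_fderiv one_ne_zero).comp hzc.continuous).clm_apply continuous_const)
  change |∫ y, η y * fderiv ℝ w (z y) ((1 - 2 * τ) • f x - f (z y))| ≤ _
  simp only [hsum]
  rw [integral_finsetSum _ fun k _ => hint k]
  refine (Finset.abs_sum_le_sum_abs _ _).trans ?_
  have hterm : ∀ k ∈ Finset.univ, |∫ y, -(lineDeriv ℝ u y (b k) * (η y * F k y))|
      ≤ (Λ * (K * (4 * R + 1)) + B * K) * θ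
        * (volume : Measure (State n)).real (closedBall 0 1) := by
    intro k _
    rw [integral_neg, abs_neg]
    have := abs_integral_lineDeriv_mul_le
      (lipschitzWith_mul_of_support hη hηB hη0 (hF k) (hFC k))
      (fun y hy => by rw [hη0 y hy, zero_mul]) hu hθ (b k)
    simpa [b] using this
  simpa using Finset.sum_le_card_nsmul _ _ _ hterm

lemma exists_mollifier : ∃ η : State n → ℝ, ContDiff ℝ ∞ η ∧ HasCompactSupport η ∧
    (∀ y, 0 ≤ η y) ∧ (∀ y, 1 ≤ ‖y‖ → η y = 0) ∧ ∫ y, η y = 1 := by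
  set β : ContDiffBump (0 : State n) := ⟨1 / 2, 1, by norm_num, by norm_num⟩
  refine ⟨β.normed volume, β.contDiff_normed, β.hasCompactSupport_normed, β.nonneg_normed,
    fun y hy => ?_, β.integral_normed⟩
  rw [← Function.notMem_support, β.support_normed_eq]
  simpa [β] using hy

/-- An average of `h` with respect to a mollifier stays as close to `c` as the values of `h`. -/
lemma abs_average_sub_le {η h : State n → ℝ} (hη : Continuous η) (hηc : HasCompactSupport η)
    (hηpos : ∀ y, 0 ≤ η y) (hη0 : ∀ y, 1 ≤ ‖y‖ → η y = 0) (hη1 : ∫ y, η y = 1)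
    (hh : Continuous h) {c θ : ℝ} (hhc : ∀ y, ‖y‖ ≤ 1 → |h y - c| ≤ θ) :
    |(∫ y, η y * h y) - c| ≤ θ := by
  have hint : Integrable η := hη.integrable_of_hasCompactSupport hηc
  have hint' : Integrable fun y => η y * h y :=
    (hη.mul hh).integrable_of_hasCompactSupport hηc.mul_right
  have h1 : (∫ y, η y * h y) - c = ∫ y, η y * (h y - c) := by
    simp only [mul_sub]
    rw [integral_sub hint' (hint.mul_const c), integral_mul_const, hη1, one_mul]
  have h2 : θ = ∫ y, η y * θ := by rw [integral_mul_const, hη1, one_mul]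
  rw [h1, ← Real.norm_eq_abs, h2]
  refine norm_integral_le_of_norm_le (hint.mul_const θ) (ae_of_all _ fun y => ?_)
  rw [norm_mul, Real.norm_of_nonneg (hηpos y), Real.norm_eq_abs]
  by_cases hy : ‖y‖ ≤ 1
  · exact mul_le_mul_of_nonneg_left (hhc y hy) (hηpos y)
  · simp [hη0 y (not_le.1 hy).le]

/-- A function that is continuous on the closed cube and `C¹` inside, and whose derivative along a
Lipschitz vector field extends continuously to the closed cube, is approximated on the closed cube
by a smooth function together with its derivative along the vector field. No bound on the full
gradient near the boundary is needed: the function is contracted towards the origin by the factor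
`1 - 2τ` and mollified at scale `τ`, and `abs_integral_commutator_le` controls the error. -/
theorem exists_smooth_approx {f : State n → State n} {K : NNReal} (hf : LipschitzWith K f)
    (hf₀ : f 0 = 0) {v g : State n → ℝ} (hv : ContinuousOn v (closure (cube n)))
    (hv1 : ContDiffOn ℝ 1 v (cube n)) (hg : ContinuousOn g (closure (cube n)))
    (hvg : ∀ x ∈ cube n, fderiv ℝ v x (f x) = g x) {ρ : ℝ} (hρ : 0 < ρ) (hρ1 : ρ ≤ 1)
    (hv0 : ∀ x ∈ cube n, ‖x‖ < 2 * ρ → v x = 0) {δ : ℝ} (hδ : 0 < δ) :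
    ∃ U : State n → ℝ, ContDiff ℝ ∞ U ∧ HasCompactSupport U ∧ (∀ x, ‖x‖ < ρ → U x = 0) ∧
      ∀ x ∈ closure (cube n), |U x - v x| ≤ δ ∧ |fderiv ℝ U x (f x) - g x| ≤ δ := by
  obtain ⟨η, hη, hηc, hηpos, hη0, hη1⟩ := exists_mollifier (n := n)
  obtain ⟨Λ, hηL⟩ := ContDiff.lipschitzWith_of_hasCompactSupport hηc hη (by simp)
  obtain ⟨B, hB⟩ := hη.continuous.bounded_above_of_compact_support hηc
  have hB0 : 0 ≤ B := (norm_nonneg _).trans (hB 0)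
  lift B to NNReal using hB0
  set R : NNReal := NNReal.sqrt n
  have hR : (R : ℝ) = √n := by simp [R]
  set M : ℝ := n * ((Λ * (K * (4 * R + 1)) + B * K)
    * (volume : Measure (State n)).real (closedBall 0 1))
  have hM : 0 ≤ M := by positivity
  set θ := δ / (1 + M)
  have hθ : 0 < θ := by positivity
  have hθδ : θ * (1 + M) = δ := by simp only [θ]; field_simp
  obtain ⟨r₁, hr₁, hvr⟩ := Metric.uniformContinuousOn_iff.1
    (isCompact_closure_cube.uniformContinuousOn_of_continuous hv) θ hθ
  obtain ⟨r₂, hr₂, hgr⟩ := Metric.uniformContinuousOn_iff.1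
    (isCompact_closure_cube.uniformContinuousOn_of_continuous hg) θ hθ
  -- The scale of the mollification.
  obtain ⟨τ, hτ, hτ2, hτρ, hτr₁, hτr₂⟩ : ∃ τ > 0, τ < 1 / 2 ∧ τ < ρ ∧ τ * (2 * √n + 1) < r₁ ∧
      τ * (2 * √n + 1) < r₂ := by
    have hlim : Tendsto (fun τ : ℝ => τ * (2 * √n + 1)) (𝓝[>] 0) (𝓝 0) := by
      have : Continuous fun τ : ℝ => τ * (2 * √n + 1) := by fun_prop
      simpa using (this.tendsto 0).mono_left nhdsWithin_le_nhds
    have hid : Tendsto (fun τ : ℝ => τ) (𝓝[>] 0) (𝓝 0) := nhdsWithin_le_nhds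
    have hpos : ∀ᶠ τ : ℝ in 𝓝[>] 0, 0 < τ := self_mem_nhdsWithin
    obtain ⟨τ, h⟩ := (hpos.and
      ((hid.eventually (gt_mem_nhds (show (0 : ℝ) < 1 / 2 by norm_num))).and
      ((hid.eventually (gt_mem_nhds hρ)).and ((hlim.eventually (gt_mem_nhds hr₁)).and
      (hlim.eventually (gt_mem_nhds hr₂)))))).exists
    exact ⟨τ, h.1, h.2.1, h.2.2.1, h.2.2.2.1, h.2.2.2.2⟩
  set s := 1 - 2 * τ with hs
  have hs0 : 0 < s := by linarith
  set C : Set (State n) := (fun x => (1 - τ) • x) '' closure (cube n)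
  have hC : IsCompact C := isCompact_closure_cube.image (by fun_prop)
  have hCs : C ⊆ cube n := by
    rintro _ ⟨x, hx, rfl⟩
    exact smul_mem_cube (mem_closure_cube.1 hx) (by linarith) (by linarith)
  have hzC : ∀ x ∈ closure (cube n), ∀ y : State n, ‖y‖ ≤ 1 → s • x - τ • y ∈ C := by
    intro x hx y hy
    refine ⟨(1 - τ)⁻¹ • (s • x - τ • y), mem_closure_cube.2 fun k => ?_, ?_⟩
    · have h1 := mem_closure_cube.1 hx k
      have h2 : |y k| ≤ 1 := by
        simpa using (PiLp.norm_apply_le (p := 2) y k).trans hy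
      have h3 : |s * x k - τ * y k| ≤ 1 - τ := by
        refine (abs_sub _ _).trans ?_
        rw [abs_mul, abs_mul, abs_of_pos hs0, abs_of_pos hτ]
        nlinarith
      have h4 : 0 < 1 - τ := by linarith
      simp only [PiLp.smul_apply, PiLp.sub_apply, smul_eq_mul]
      rw [abs_mul, abs_of_pos (inv_pos.2 h4), inv_mul_le_iff₀ h4]
      linarith
    · simp only
      rw [smul_inv_smul₀ (by linarith)]
  have hzx : ∀ x ∈ closure (cube n), ∀ y : State n, ‖y‖ ≤ 1 →
      dist (s • x - τ • y) x ≤ τ * (2 * √n + 1) := by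
    intro x hx y hy
    have : s • x - τ • y - x = -((2 * τ) • x + τ • y) := by rw [hs]; module
    rw [dist_eq_norm, this, norm_neg]
    refine (norm_add_le _ _).trans ?_
    rw [norm_smul, norm_smul, Real.norm_of_nonneg hτ.le, Real.norm_of_nonneg (by positivity)]
    nlinarith [norm_le_of_mem_closure_cube hx]
  obtain ⟨w, hw, hwc, hwv⟩ := exists_compactly_supported_extension isOpen_cube hC hCs hv1
  obtain ⟨hW, hWc, hWd⟩ := mollification hη hηc hw hwc hτ
  set W : State n → ℝ := fun x => ∫ y, η y * w (x - τ • y)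
  refine ⟨fun x => W (s • x), hW.comp (contDiff_const_smul s),
    hWc.comp_homeomorph (Homeomorph.smulOfNeZero s hs0.ne'), fun x hx => ?_, fun x hx => ⟨?_, ?_⟩⟩
  · have hxc : x ∈ closure (cube n) := mem_closure_cube.2 fun k => by
      have := (PiLp.norm_apply_le (p := 2) x k).trans (hx.le.trans hρ1)
      simpa using this
    refine integral_eq_zero_of_ae (ae_of_all _ fun y => ?_)
    by_cases hy : ‖y‖ ≤ 1
    · have hz := hzC x hxc y hy
      have h2 : ‖s • x - τ • y‖ < 2 * ρ := by
        refine (norm_sub_le _ _).trans_lt ?_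
        rw [norm_smul, norm_smul, Real.norm_of_nonneg hτ.le, Real.norm_of_nonneg hs0.le]
        nlinarith [norm_nonneg x, norm_nonneg y]
      simp [(hwv _ hz).self_of_nhds, hv0 _ (hCs hz) h2]
    · simp [hη0 y (not_le.1 hy).le]
  · have h1 : |W (s • x) - v x| ≤ θ := by
      refine abs_average_sub_le hη.continuous hηc hηpos hη0 hη1
        (hw.continuous.comp (by fun_prop)) fun y hy => ?_
      have hz := hzC x hx y hy
      have := hvr _ (subset_closure (hCs hz)) _ hx ((hzx x hx y hy).trans_lt hτr₁)
      rw [Real.dist_eq, ← (hwv _ hz).self_of_nhds] at this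
      exact this.le
    refine h1.trans ?_
    nlinarith
  · have hzcont : Continuous fun y : State n => s • x - τ • y := by fun_prop
    have hdc : Continuous fun y : State n => fderiv ℝ w (s • x - τ • y) :=
      (hw.continuous_fderiv one_ne_zero).comp hzcont
    have hd : HasFDerivAt (fun x => W (s • x))
        ((∫ y, η y • fderiv ℝ w (s • x - τ • y)).comp (s • ContinuousLinearMap.id ℝ (State n)))
        x :=
      (hWd (s • x)).comp x ((hasFDerivAt_id x).const_smul s)
    have hint : Integrable fun y => η y • fderiv ℝ w (s • x - τ • y) :=
      (hη.continuous.smul hdc).integrable_of_hasCompactSupport hηc.smul_right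
    have hcontg : Continuous fun y : State n =>
        fderiv ℝ w (s • x - τ • y) (f (s • x - τ • y)) :=
      hdc.clm_apply (hf.continuous.comp hzcont)
    have hcontc : Continuous fun y : State n =>
        fderiv ℝ w (s • x - τ • y) (s • f x - f (s • x - τ • y)) :=
      hdc.clm_apply (continuous_const.sub (hf.continuous.comp hzcont))
    have hint₁ : Integrable fun y =>
        η y * fderiv ℝ w (s • x - τ • y) (f (s • x - τ • y)) :=
      (hη.continuous.mul hcontg).integrable_of_hasCompactSupport hηc.mul_right
    have hint₂ : Integrable fun y =>
        η y * fderiv ℝ w (s • x - τ • y) (s • f x - f (s • x - τ • y)) :=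
      (hη.continuous.mul hcontc).integrable_of_hasCompactSupport hηc.mul_right
    have hval : fderiv ℝ (fun x => W (s • x)) x (f x)
        = (∫ y, η y * fderiv ℝ w (s • x - τ • y) (f (s • x - τ • y)))
          + ∫ y, η y * fderiv ℝ w (s • x - τ • y) (s • f x - f (s • x - τ • y)) := by
      rw [hd.fderiv, ContinuousLinearMap.comp_apply, ContinuousLinearMap.integral_apply hint,
        ← integral_add hint₁ hint₂]
      congr 1
      ext y
      simp [mul_sub]
      ring
    have h1 : |(∫ y, η y * fderiv ℝ w (s • x - τ • y) (f (s • x - τ • y))) - g x| ≤ θ := by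
      refine abs_average_sub_le hη.continuous hηc hηpos hη0 hη1 hcontg fun y hy => ?_
      have hz := hzC x hx y hy
      rw [(hwv _ hz).fderiv_eq, hvg _ (hCs hz)]
      have := hgr _ (subset_closure (hCs hz)) _ hx ((hzx x hx y hy).trans_lt hτr₂)
      rw [Real.dist_eq] at this
      exact this.le
    have h2 := abs_integral_commutator_le (R := R) (x := x) (c := v x) (θ := θ)
      hf hf₀ hηL hB hη0 hw hwc hτ (by rw [hR]; exact norm_le_of_mem_closure_cube hx)
      fun y hy => by
        have hz := hzC x hx y hy
        rw [← hs, (hwv _ hz).self_of_nhds]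
        have := hvr _ (subset_closure (hCs hz)) _ hx ((hzx x hx y hy).trans_lt hτr₁)
        rw [Real.dist_eq] at this
        exact this.le
    rw [← hs] at h2
    rw [hval]
    have h3 := abs_le.1 h1
    have h4 := abs_le.1 h2
    have h5 : n * ((Λ * (K * (4 * R + 1)) + B * K) * θ
        * (volume : Measure (State n)).real (closedBall 0 1)) = M * θ := by
      simp only [M]; ring
    rw [h5] at h4
    rw [abs_le]
    constructor <;> linarith [h3.1, h3.2, h4.1, h4.2]

/-! ### Quadratic forms near the equilibrium -/

/-- The quadratic form `x ↦ ½ xᵀ P x`. -/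
noncomputable def quadForm (P : Matrix (Fin n) (Fin n) ℝ) (x : State n) : ℝ :=
  1 / 2 * (x.ofLp ⬝ᵥ (P *ᵥ x.ofLp))

lemma quadForm_smul (a : ℝ) (P : Matrix (Fin n) (Fin n) ℝ) (x : State n) :
    quadForm (a • P) x = a * quadForm P x := by
  rw [quadForm, quadForm, Matrix.smul_mulVec, dotProduct_smul, smul_eq_mul]; ring

lemma dotProduct_self_eq (x : State n) : x.ofLp ⬝ᵥ x.ofLp = ‖x‖ ^ 2 := by
  rw [EuclideanSpace.norm_sq_eq]
  simp [dotProduct, sq]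

lemma dotProduct_mulVec_eq_inner (P : Matrix (Fin n) (Fin n) ℝ) (x y : State n) :
    x.ofLp ⬝ᵥ (P *ᵥ y.ofLp) = inner ℝ x (Matrix.toEuclideanCLM (𝕜 := ℝ) P y) := by
  rw [EuclideanSpace.inner_eq_star_dotProduct, dotProduct_comm, Matrix.ofLp_toEuclideanCLM]
  simp

lemma quadForm_eq_inner (P : Matrix (Fin n) (Fin n) ℝ) :
    quadForm P = fun x => 1 / 2 * inner ℝ x (Matrix.toEuclideanCLM (𝕜 := ℝ) P x) := by
  ext x
  rw [quadForm, dotProduct_mulVec_eq_inner]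

lemma contDiff_quadForm (P : Matrix (Fin n) (Fin n) ℝ) : ContDiff ℝ ∞ (quadForm P) := by
  rw [quadForm_eq_inner]
  exact contDiff_const.mul (contDiff_id.inner ℝ (ContinuousLinearMap.contDiff _))

lemma fderiv_quadForm {P : Matrix (Fin n) (Fin n) ℝ} (hP : Pᵀ = P) (x w : State n) :
    fderiv ℝ (quadForm P) x w = x.ofLp ⬝ᵥ (P *ᵥ w.ofLp) := by
  set T := Matrix.toEuclideanCLM (n := Fin n) (𝕜 := ℝ) P
  have h1 : HasFDerivAt (fun x : State n => inner ℝ x (T x)) _ x :=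
    (hasFDerivAt_id x).inner ℝ (T.hasFDerivAt (x := x))
  rw [quadForm_eq_inner, (h1.const_mul (1 / 2)).fderiv]
  have h2 : inner ℝ w (T x) = inner ℝ x (T w) := by
    rw [← dotProduct_mulVec_eq_inner, ← dotProduct_mulVec_eq_inner, Matrix.dotProduct_mulVec,
      ← Matrix.mulVec_transpose, hP, dotProduct_comm]
  rw [dotProduct_mulVec_eq_inner]
  simp [h2, T]
  ring

/-- Along a vector field with linearization `A`, the quadratic form of a Lyapunov matrix of `A`
decreases quadratically near the origin. -/
lemma exists_quadForm_decreasing {f : State n → State n} {A P : Matrix (Fin n) (Fin n) ℝ}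
    (hA : (fun x : State n => f x - WithLp.toLp 2 (A *ᵥ x.ofLp)) =o[𝓝 0] fun x => x)
    (hP : Pᵀ = P) {c : ℝ} (hc : 0 < c)
    (hPA : ∀ x, x ⬝ᵥ ((Aᵀ * P + P * A) *ᵥ x) ≤ -c * (x ⬝ᵥ x)) :
    ∃ r > 0, ∀ x : State n, ‖x‖ < r →
      fderiv ℝ (quadForm P) x (f x) ≤ -(c / 4) * ‖x‖ ^ 2 := by
  set T := Matrix.toEuclideanCLM (n := Fin n) (𝕜 := ℝ) P
  have hb : 0 < c / (4 * (‖T‖ + 1)) := by positivity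
  obtain ⟨r, hr, hrx⟩ := Metric.eventually_nhds_iff.1 (hA.def hb)
  refine ⟨r, hr, fun x hx => ?_⟩
  have h1 := hrx (show dist x 0 < r by simpa using hx)
  set y : State n := WithLp.toLp 2 (A *ᵥ x.ofLp) with hy
  have hsplit : f x = y + (f x - y) := by abel
  have h2 : x.ofLp ⬝ᵥ (P *ᵥ y.ofLp) ≤ -(c / 2) * ‖x‖ ^ 2 := by
    have h3 := hPA x.ofLp
    rw [Matrix.add_mulVec, dotProduct_add, ← Matrix.mulVec_mulVec, ← Matrix.mulVec_mulVec,
      Matrix.dotProduct_mulVec, Matrix.vecMul_transpose, dotProduct_self_eq] at h3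
    have h4 : (A *ᵥ x.ofLp) ⬝ᵥ (P *ᵥ x.ofLp) = x.ofLp ⬝ᵥ (P *ᵥ (A *ᵥ x.ofLp)) := by
      rw [Matrix.dotProduct_mulVec, ← Matrix.mulVec_transpose, hP, dotProduct_comm]
    rw [h4] at h3
    simp only [hy]
    linarith
  have h5 : fderiv ℝ (quadForm P) x (f x - y) ≤ (c / 4) * ‖x‖ ^ 2 := by
    rw [fderiv_quadForm hP, dotProduct_mulVec_eq_inner]
    refine (real_inner_le_norm _ _).trans ?_
    have h6 : ‖T (f x - y)‖ ≤ (‖T‖ + 1) * (c / (4 * (‖T‖ + 1)) * ‖x‖) := by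
      refine (T.le_opNorm _).trans ?_
      gcongr
      linarith
    have h7 : (‖T‖ + 1) * (c / (4 * (‖T‖ + 1)) * ‖x‖) = c / 4 * ‖x‖ := by field_simp
    rw [h7] at h6
    calc ‖x‖ * ‖T (f x - y)‖ ≤ ‖x‖ * (c / 4 * ‖x‖) := by gcongr
      _ = c / 4 * ‖x‖ ^ 2 := by ring
  rw [hsplit, map_add, fderiv_quadForm hP x y]
  linarith

/-! ### A strict Lyapunov function that survives small perturbations -/

lemma hasDerivAt_sq_max (a t : ℝ) :
    HasDerivAt (fun t => max (t - a) 0 ^ 2) (2 * max (t - a) 0) t := by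
  rcases lt_trichotomy t a with h | h | h
  · rw [max_eq_right (by linarith), mul_zero]
    refine (hasDerivAt_const t (0 : ℝ)).congr_of_eventuallyEq ?_
    filter_upwards [gt_mem_nhds h] with s hs
    simp [max_eq_right (show s - a ≤ 0 by linarith)]
  · subst h
    simp only [sub_self, max_self, mul_zero]
    rw [hasDerivAt_iff_isLittleO]
    have h1 : (fun s : ℝ => (s - t) ^ 2) =o[𝓝 t] fun s => s - t := by
      have h0 : Tendsto (fun s : ℝ => s - t) (𝓝 t) (𝓝 0) := by
        have : Continuous fun s : ℝ => s - t := by fun_prop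
        simpa using this.tendsto t
      exact (Asymptotics.isLittleO_pow_id (𝕜 := ℝ) one_lt_two).comp_tendsto h0
    refine (Asymptotics.IsBigO.of_bound 1 (Eventually.of_forall fun s => ?_)).trans_isLittleO h1
    simp only [sub_self, max_self, smul_zero, sub_zero, one_mul, norm_pow, Real.norm_eq_abs]
    rw [zero_pow two_ne_zero, sub_zero, abs_pow, sq_abs, sq_abs]
    rcases le_total (s - t) 0 with h | h
    · rw [max_eq_right h, zero_pow two_ne_zero]; exact sq_nonneg _
    · rw [max_eq_left h]
  · rw [max_eq_left (by linarith)]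
    have h1 : HasDerivAt (fun s : ℝ => (s - a) ^ 2) (2 * (t - a)) t := by
      convert! ((hasDerivAt_id t).sub_const a).pow 2 using 1
      simp
    refine h1.congr_of_eventuallyEq ?_
    filter_upwards [lt_mem_nhds h] with s hs
    rw [max_eq_left (by linarith)]

lemma contDiff_sq_max (a : ℝ) : ContDiff ℝ 1 fun t : ℝ => max (t - a) 0 ^ 2 := by
  rw [contDiff_one_iff_deriv]
  refine ⟨fun t => (hasDerivAt_sq_max a t).differentiableAt, ?_⟩
  rw [funext fun t => (hasDerivAt_sq_max a t).deriv]
  fun_prop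

lemma eventually_mul_le (C : ℝ) {b : ℝ} (hb : 0 < b) : ∀ᶠ t : ℝ in 𝓝[>] 0, t * C ≤ b := by
  have h : Tendsto (fun t : ℝ => t * C) (𝓝[>] 0) (𝓝 0) := by
    have : Continuous fun t : ℝ => t * C := by fun_prop
    simpa using (this.tendsto 0).mono_left nhdsWithin_le_nhds
  filter_upwards [h.eventually (gt_mem_nhds hb)] with t ht using ht.le

/-- A strict Lyapunov function `W` whose sublevel set at `ℓ` lies with a margin between the required
bounds tolerates every `C¹` perturbation of second order at the origin with a small constant. -/
lemma exists_perturbation_bound {f : State n → State n} (hf : Continuous f) {V W : State n → ℝ}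
    (hV : IsLyapunovFunction f V) (hW : ContDiff ℝ 1 W) (hW₀ : W 0 = 0) {β ℓ ε ε' : ℝ} (hβ : 0 < β)
    (hℓ : 0 < ℓ) (hε' : 0 < ε') (hpos : ∀ x ∈ closure (cube n), β * ‖x‖ ^ 2 ≤ W x)
    (hdec : ∀ x ∈ cube n, x ≠ 0 → V x ≤ 1 - ε' → fderiv ℝ W x (f x) ≤ -β * ‖x‖ ^ 2)
    (hlev : ∀ x ∈ closure (cube n), W x < ℓ + β → V x ≤ 1 - ε')
    (hsub : ∀ x ∈ cube n, V x ≤ 1 - ε → W x ≤ ℓ - β) :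
    ∃ κ > 0, ∀ E : State n → ℝ, ContDiff ℝ 1 E →
      (∀ x ∈ closure (cube n), |E x| ≤ κ * ‖x‖ ^ 2 ∧ ‖fderiv ℝ E x‖ ≤ κ * ‖x‖ ^ 2) →
      IsLyapunovFunction f (fun x => ℓ⁻¹ * W x + E x) ∧
      {x | x ∈ cube n ∧ V x ≤ 1 - ε} ⊆ basin (fun x => ℓ⁻¹ * W x + E x) ∧
      basin (fun x => ℓ⁻¹ * W x + E x) ⊆ basin V := by
  obtain ⟨F, hF⟩ := isCompact_closure_cube.exists_bound_of_continuousOn hf.continuousOn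
  have hF0 : 0 ≤ F := (norm_nonneg _).trans (hF 0 (subset_closure zero_mem_cube))
  have hpos' : ∀ᶠ t : ℝ in 𝓝[>] 0, 0 < t := self_mem_nhdsWithin
  obtain ⟨κ, hκ, hκ1, hκn, hκF⟩ := (hpos'.and
    ((eventually_mul_le 1 (half_pos hβ)).and ((eventually_mul_le n (half_pos hβ)).and
    (eventually_mul_le F (half_pos hβ))))).exists
  have hℓ' : 0 < ℓ⁻¹ := inv_pos.2 hℓ
  refine ⟨ℓ⁻¹ * κ, by positivity, fun E hE hEb => ?_⟩
  set G : State n → ℝ := fun x => W x + ℓ * E x with hG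
  have hGeq : (fun x => ℓ⁻¹ * W x + E x) = fun x => ℓ⁻¹ * G x := by
    ext x
    rw [hG]
    field_simp
  rw [hGeq]
  have hGs : ContDiff ℝ 1 G := hW.add (contDiff_const.mul hE)
  have hGf : ∀ x, fderiv ℝ (fun x => ℓ⁻¹ * G x) x (f x)
      = ℓ⁻¹ * (fderiv ℝ W x (f x) + ℓ * fderiv ℝ E x (f x)) := by
    intro x
    have h2 : HasFDerivAt (fun x => ℓ⁻¹ * G x) _ x :=
      ((hW.differentiable one_ne_zero x).hasFDerivAt.add
        ((hE.differentiable one_ne_zero x).hasFDerivAt.const_mul ℓ)).const_mul ℓ⁻¹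
    rw [h2.fderiv]
    simp [mul_add]
  have hlt : ∀ x, ℓ⁻¹ * G x < 1 ↔ G x < ℓ := by
    intro x
    rw [inv_mul_lt_iff₀ hℓ, mul_one]
  have hEκ : ∀ x ∈ closure (cube n), |ℓ * E x| ≤ κ * ‖x‖ ^ 2 := by
    intro x hx
    have h1 := (hEb x hx).1
    rw [abs_mul, abs_of_pos hℓ]
    calc ℓ * |E x| ≤ ℓ * (ℓ⁻¹ * κ * ‖x‖ ^ 2) := by gcongr
      _ = κ * ‖x‖ ^ 2 := by field_simp
  have hEn : ∀ x ∈ closure (cube n), |ℓ * E x| ≤ β / 2 := by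
    intro x hx
    have hnx := pow_le_pow_left₀ (norm_nonneg x) (norm_le_of_mem_closure_cube hx) 2
    rw [Real.sq_sqrt (Nat.cast_nonneg n)] at hnx
    exact (hEκ x hx).trans ((mul_le_mul_of_nonneg_left hnx hκ.le).trans hκn)
  have hEf : ∀ x ∈ closure (cube n), |ℓ * fderiv ℝ E x (f x)| ≤ β / 2 * ‖x‖ ^ 2 := by
    intro x hx
    have h1 := (hEb x hx).2
    rw [abs_mul, abs_of_pos hℓ]
    have h2 : |fderiv ℝ E x (f x)| ≤ (ℓ⁻¹ * κ * ‖x‖ ^ 2) * F := by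
      refine ((fderiv ℝ E x).le_opNorm _).trans ?_
      gcongr
      exact hF x hx
    calc ℓ * |fderiv ℝ E x (f x)| ≤ ℓ * ((ℓ⁻¹ * κ * ‖x‖ ^ 2) * F) := by gcongr
      _ = κ * F * ‖x‖ ^ 2 := by field_simp
      _ ≤ β / 2 * ‖x‖ ^ 2 := by gcongr
  have hlevel : ∀ x ∈ closure (cube n), G x < ℓ → V x ≤ 1 - ε' := by
    intro x hx hGx
    have h3 := abs_le.1 (hEn x hx)
    simp only [hG] at hGx
    exact hlev x hx (by linarith [h3.1])
  refine ⟨⟨(contDiff_const.mul hGs).contDiffOn,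
    (continuous_const.mul hGs.continuous).continuousOn, ?_, ?_, ?_, ?_⟩, ?_, ?_⟩
  · have h1 := hEκ 0 (subset_closure zero_mem_cube)
    rw [norm_zero, zero_pow two_ne_zero, mul_zero, abs_nonpos_iff] at h1
    simp [hG, hW₀, h1]
  · intro x hx hx0
    refine mul_pos hℓ' ?_
    have h1 := hpos x (subset_closure hx)
    have h2 := abs_le.1 (hEκ x (subset_closure hx))
    have h3 : 0 < ‖x‖ ^ 2 := by positivity
    simp only [hG]
    nlinarith [h2.1]
  · intro x hx hx0 hGx
    have hxc := subset_closure hx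
    have h1 := hdec x hx hx0 (hlevel x hxc ((hlt x).1 hGx))
    have h2 := abs_le.1 (hEf x hxc)
    have h3 : 0 < β * ‖x‖ ^ 2 := by positivity
    rw [hGf]
    refine mul_neg_of_pos_of_neg hℓ' ?_
    linarith [h2.2]
  · intro x hx ν hν hfν
    have hVx := hV.boundary x hx ν hν hfν
    by_contra! h
    linarith [hlevel x (mem_frontier_cube.1 hx).1 ((hlt x).1 h)]
  · rintro x ⟨hx, hVx⟩
    refine ⟨hx, (hlt x).2 ?_⟩
    have h1 := hsub x hx hVx
    have h3 := abs_le.1 (hEn x (subset_closure hx))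
    simp only [hG]
    linarith [h3.2]
  · rintro x ⟨hx, hGx⟩
    refine ⟨hx, ?_⟩
    linarith [hlevel x (subset_closure hx) ((hlt x).1 hGx)]

set_option maxHeartbeats 1000000 in
/-- The smooth function `½ xᵀ P x + U x` is a Lyapunov function with the required basin, and it
stays one under every `C¹` perturbation of second order at the origin with a small enough constant.
Here `U` approximates a multiple of `max (V* - a) 0 ²`, which vanishes near the origin; a small
multiple of a quadratic Lyapunov function of the linearization provides the decrease there. -/
theorem exists_robust_lyapunov (hn : 0 < n) {f : State n → State n} {K : NNReal}
    (hf : LipschitzWith K f) (hf₀ : f 0 = 0) {A : Matrix (Fin n) (Fin n) ℝ}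
    (hA : HasStableLinearization f A) {V : State n → ℝ} (hV : IsMaximalLyapunovFunction f V)
    {ε : ℝ} (hε : ε ∈ Ioo (0 : ℝ) 1) :
    ∃ P : Matrix (Fin n) (Fin n) ℝ, P.PosDef ∧ (-(Aᵀ * P + P * A)).PosDef ∧
      ∃ U : State n → ℝ, ContDiff ℝ ∞ U ∧ HasCompactSupport U ∧
      (∃ ρ > 0, ∀ x, ‖x‖ < ρ → U x = 0) ∧
      ∃ κ > 0, ∀ E : State n → ℝ, ContDiff ℝ 1 E →
        (∀ x ∈ closure (cube n), |E x| ≤ κ * ‖x‖ ^ 2 ∧ ‖fderiv ℝ E x‖ ≤ κ * ‖x‖ ^ 2) →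
        IsLyapunovFunction f (fun x => quadForm P x + U x + E x) ∧
        {x | x ∈ cube n ∧ V x ≤ 1 - ε} ⊆ basin (fun x => quadForm P x + U x + E x) ∧
        basin (fun x => quadForm P x + U x + E x) ⊆ basin V := by
  obtain ⟨P, hPt, hP1, c, hc, hPA⟩ := exists_lyapunov_matrix hA.2 hn
  obtain ⟨r₀, hr₀, hQdec⟩ := exists_quadForm_decreasing hA.1 hPt hc hPA
  have hD : IsCompact (closure (cube n)) := isCompact_closure_cube
  have hVc := hV.1.continuousOn
  have hVpos : ∀ x ∈ closure (cube n), x ≠ 0 → 0 < V x := fun x hx hx0 =>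
    hV.pos_of_mem_closure hf hx hx0
  have hV1 := hV.1
  obtain ⟨φ, hφ, hz⟩ := hV.2
  -- Lower bounds away from the origin.
  have hDr : IsCompact (closure (cube n) ∩ {x | r₀ ≤ ‖x‖}) :=
    hD.inter_right (isClosed_le continuous_const continuous_norm)
  have hne : ∀ x ∈ closure (cube n) ∩ {x | r₀ ≤ ‖x‖}, x ≠ 0 := by
    rintro x ⟨-, hx⟩ rfl
    simp at hx; linarith
  obtain ⟨m, hm, hmV⟩ := hDr.exists_forall_le' (hVc.mono inter_subset_left)
    fun x hx => hVpos x hx.1 (hne x hx)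
  obtain ⟨φ₀, hφ₀, hφφ⟩ := hDr.exists_forall_le' (hφ.continuousOn.mono inter_subset_left)
    fun x hx => hφ.pos x hx.1 (hne x hx)
  set a := min m 1 / 2
  have ha : 0 < a := by have := lt_min hm one_pos; positivity
  have ham : a < m := by have := min_le_left m 1; simp only [a]; linarith [lt_min hm one_pos]
  have ha1 : a < 1 := by have := min_le_right m 1; simp only [a]; linarith [lt_min hm one_pos]
  set α : ℝ → ℝ := fun t => max (t - a) 0 ^ 2 with hα
  have hα0 : ∀ t, 0 ≤ α t := fun t => sq_nonneg _
  have hαmono : Monotone α := by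
    intro s t hst
    simp only [hα]
    have : max (s - a) 0 ≤ max (t - a) 0 := max_le_max (by linarith) le_rfl
    exact pow_le_pow_left₀ (le_max_right _ _) this 2
  -- The level `ℓ` lies halfway between the values at `1 - ε` and at `1`.
  have hgap : α (1 - ε) < α 1 := by
    simp only [hα]
    rw [max_eq_left (show (0 : ℝ) ≤ 1 - a by linarith)]
    refine pow_lt_pow_left₀ (max_lt (by linarith [hε.1]) (by linarith)) (le_max_right _ _)
      two_ne_zero
  set ℓ := (α 1 + α (1 - ε)) / 2 with hℓ
  set d := (α 1 - α (1 - ε)) / 2 with hd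
  have hdpos : 0 < d := by linarith
  have hℓpos : 0 < ℓ := by linarith [hα0 (1 - ε)]
  obtain ⟨ε', hε', hαε'⟩ : ∃ ε' > 0, α 1 - d / 2 < α (1 - ε') := by
    have hc : Tendsto (fun s : ℝ => α (1 - s)) (𝓝[>] 0) (𝓝 (α 1)) := by
      have : Continuous fun s : ℝ => α (1 - s) :=
        (contDiff_sq_max a).continuous.comp (by fun_prop)
      simpa using (this.tendsto 0).mono_left nhdsWithin_le_nhds
    have hpos : ∀ᶠ s : ℝ in 𝓝[>] 0, 0 < s := self_mem_nhdsWithin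
    obtain ⟨s, hs⟩ := (hpos.and (hc.eventually
      (lt_mem_nhds (show α 1 - d / 2 < α 1 by linarith)))).exists
    exact ⟨s, hs⟩
  -- The function to be smoothed and its derivative along `f`.
  set v : State n → ℝ := fun x => α (V x)
  set g : State n → ℝ := fun x => 2 * max (V x - a) 0 * (-φ x * (1 - V x))
  have hv : ContinuousOn v (closure (cube n)) :=
    (contDiff_sq_max a).continuous.comp_continuousOn hVc
  have hv1 : ContDiffOn ℝ 1 v (cube n) := (contDiff_sq_max a).comp_contDiffOn hV1.contDiffOn
  have hg : ContinuousOn g (closure (cube n)) := by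
    refine ContinuousOn.mul (continuousOn_const.mul ?_)
      (hφ.continuousOn.neg.mul (continuousOn_const.sub hVc))
    exact (hVc.sub continuousOn_const).sup continuousOn_const
  have hvg : ∀ x ∈ cube n, fderiv ℝ v x (f x) = g x := by
    intro x hx
    have hVd : DifferentiableAt ℝ V x :=
      (hV1.contDiffOn.differentiableOn one_ne_zero).differentiableAt (isOpen_cube.mem_nhds hx)
    have h1 : HasFDerivAt v ((2 * max (V x - a) 0) • fderiv ℝ V x) x :=
      (hasDerivAt_sq_max a (V x)).comp_hasFDerivAt x hVd.hasFDerivAt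
    rw [h1.fderiv, smul_apply, hz x hx, smul_eq_mul]
  obtain ⟨ρ, hρ, hρ1, hv0⟩ : ∃ ρ > 0, ρ ≤ 1 ∧ ∀ x ∈ cube n, ‖x‖ < 2 * ρ → v x = 0 := by
    have h1 : ContinuousAt V 0 :=
      hVc.continuousAt (mem_of_superset (isOpen_cube.mem_nhds zero_mem_cube) subset_closure)
    have h2 : ∀ᶠ x in 𝓝 0, V x < a := by
      refine h1.eventually (gt_mem_nhds ?_)
      rwa [hV1.map_zero]
    obtain ⟨s, hs, hsV⟩ := Metric.eventually_nhds_iff.1 h2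
    refine ⟨min (s / 2) 1, by positivity, min_le_right _ _, fun x _ hx => ?_⟩
    have h3 : V x < a := hsV (by
      rw [dist_zero_right]
      linarith [min_le_left (s / 2) 1])
    simp [v, hα, max_eq_right (show V x - a ≤ 0 by linarith)]
  -- Upper bounds on the closed cube.
  obtain ⟨N₁, hN₁⟩ := hD.exists_bound_of_continuousOn (f := fun x => fderiv ℝ (quadForm P) x (f x))
    ((((contDiff_quadForm P).continuous_fderiv (by simp)).clm_apply hf.continuous).continuousOn)
  obtain ⟨N₂, hN₂⟩ := hD.exists_bound_of_continuousOn (contDiff_quadForm P).continuous.continuousOn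
  have hnorm : ∀ x ∈ closure (cube n), ‖x‖ ^ 2 ≤ n := by
    intro x hx
    have := pow_le_pow_left₀ (norm_nonneg x) (norm_le_of_mem_closure_cube hx) 2
    rwa [Real.sq_sqrt (Nat.cast_nonneg n)] at this
  set c₂ := 2 * (m - a) * (φ₀ * ε')
  have hc₂ : 0 < c₂ := by have := sub_pos.2 ham; positivity
  -- The weight of the quadratic form, then the accuracies of the approximations.
  have hpos : ∀ᶠ t : ℝ in 𝓝[>] 0, 0 < t := self_mem_nhdsWithin
  obtain ⟨μ, hμ, hμN₁, hμN₂⟩ := (hpos.and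
    ((eventually_mul_le N₁ (show 0 < c₂ / 4 by positivity)).and
    (eventually_mul_le N₂ (show 0 < d / 4 by positivity)))).exists
  obtain ⟨δ, hδ, hδd, hδc₂, hδμ, hδμc⟩ := (hpos.and
    ((eventually_mul_le 1 (show 0 < d / 4 by positivity)).and
    ((eventually_mul_le 1 (show 0 < c₂ / 4 by positivity)).and
    ((eventually_mul_le (1 / ρ ^ 2) (show 0 < μ / 8 by positivity)).and
    (eventually_mul_le (1 / ρ ^ 2) (show 0 < μ * c / 16 by positivity)))))).exists
  obtain ⟨β, hβ, hβd, hβc₂, hβμ, hβμc⟩ := (hpos.and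
    ((eventually_mul_le 1 (show 0 < d / 4 by positivity)).and
    ((eventually_mul_le n (show 0 < c₂ / 2 by positivity)).and
    ((eventually_mul_le 1 (show 0 < μ / 4 by positivity)).and
    (eventually_mul_le 1 (show 0 < μ * c / 8 by positivity)))))).exists
  obtain ⟨U, hU, hUc, hU0, hUv⟩ := exists_smooth_approx hf hf₀ hv hv1 hg hvg hρ hρ1 hv0 hδ
  have hℓ' : 0 < ℓ⁻¹ := inv_pos.2 hℓpos
  have hdot : ∀ x : Fin n → ℝ, x ≠ 0 → 0 < x ⬝ᵥ x := by
    intro x hx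
    have h1 := dotProduct_self_eq (WithLp.toLp 2 x : State n)
    simp only at h1
    rw [h1]
    have : (WithLp.toLp 2 x : State n) ≠ 0 := fun h => hx (by simpa using h)
    positivity
  have hQ0 : ∀ x, 1 / 2 * ‖x‖ ^ 2 ≤ quadForm P x := by
    intro x
    rw [quadForm, ← dotProduct_self_eq]
    linarith [hP1 x.ofLp]
  set W : State n → ℝ := fun x => μ * quadForm P x + U x with hW
  have hWf : ∀ x, fderiv ℝ W x (f x)
      = μ * fderiv ℝ (quadForm P) x (f x) + fderiv ℝ U x (f x) := by
    intro x
    have h2 : HasFDerivAt W _ x :=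
      (((contDiff_quadForm P).differentiable (by simp) x).hasFDerivAt.const_mul μ).add
        (hU.differentiable (by simp) x).hasFDerivAt
    rw [h2.fderiv]
    simp
  have hWpos : ∀ x ∈ closure (cube n), β * ‖x‖ ^ 2 ≤ W x := by
    intro x hx
    have h1 : -(μ / 8) * ‖x‖ ^ 2 ≤ U x := by
      by_cases hxρ : ‖x‖ < ρ
      · have h2 : 0 ≤ μ * ‖x‖ ^ 2 := by positivity
        rw [hU0 x hxρ]
        linarith only [h2]
      · have h2 := abs_le.1 (hUv x hx).1
        have h3 : 0 ≤ v x := hα0 _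
        have h4 : ρ ^ 2 ≤ ‖x‖ ^ 2 := pow_le_pow_left₀ hρ.le (not_lt.1 hxρ) 2
        have h5 : δ ≤ μ / 8 * ρ ^ 2 := by
          have := mul_le_mul_of_nonneg_right hδμ (sq_nonneg ρ)
          have h6 : δ * (1 / ρ ^ 2) * ρ ^ 2 = δ := by field_simp
          linarith only [this, h6]
        have h6 : μ / 8 * ρ ^ 2 ≤ μ / 8 * ‖x‖ ^ 2 := by gcongr
        linarith only [h2.1, h3, h5, h6]
    have h4 := mul_le_mul_of_nonneg_left (hQ0 x) hμ.le
    have h5 : β * ‖x‖ ^ 2 ≤ μ / 4 * ‖x‖ ^ 2 := by gcongr; linarith only [hβμ]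
    have h6 : 0 ≤ μ * ‖x‖ ^ 2 := by positivity
    simp only [hW]
    linarith only [h1, h4, h5, h6]
  have hWdec : ∀ x ∈ cube n, x ≠ 0 → V x ≤ 1 - ε' →
      fderiv ℝ W x (f x) ≤ -β * ‖x‖ ^ 2 := by
    intro x hx hx0 hVx
    have hxc := subset_closure hx
    rw [hWf]
    have h1 := abs_le.1 (hUv x hxc).2
    by_cases hxr : ‖x‖ < r₀
    · have h3 := mul_le_mul_of_nonneg_left (hQdec x hxr) hμ.le
      have h4 : 0 < μ * c * ‖x‖ ^ 2 := by positivity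
      have h5 : fderiv ℝ U x (f x) ≤ μ * c / 16 * ‖x‖ ^ 2 := by
        by_cases hxρ : ‖x‖ < ρ
        · have hev : U =ᶠ[𝓝 x] fun _ => 0 := by
            filter_upwards [(isOpen_lt continuous_norm continuous_const).mem_nhds hxρ] with y hy
            exact hU0 y hy
          rw [hev.fderiv_eq, fderiv_const_apply, zero_apply]
          positivity
        · have h6 : g x ≤ 0 := by
            have h7 : 0 ≤ 2 * max (V x - a) 0 := by positivity
            have h8 := hφ.pos x hxc hx0
            have h9 : 0 ≤ φ x * (1 - V x) := mul_nonneg h8.le (by linarith)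
            have h10 : g x = -(2 * max (V x - a) 0 * (φ x * (1 - V x))) := by
              simp only [g]
              ring
            rw [h10]
            exact neg_nonpos.2 (mul_nonneg h7 h9)
          have h7 : ρ ^ 2 ≤ ‖x‖ ^ 2 := pow_le_pow_left₀ hρ.le (not_lt.1 hxρ) 2
          have h8 : δ ≤ μ * c / 16 * ρ ^ 2 := by
            have := mul_le_mul_of_nonneg_right hδμc (sq_nonneg ρ)
            have h6 : δ * (1 / ρ ^ 2) * ρ ^ 2 = δ := by field_simp
            linarith only [this, h6]
          have h9 : μ * c / 16 * ρ ^ 2 ≤ μ * c / 16 * ‖x‖ ^ 2 := by gcongr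
          linarith only [h1.2, h6, h8, h9]
      have h6 : β * ‖x‖ ^ 2 ≤ μ * c / 8 * ‖x‖ ^ 2 := by gcongr; linarith only [hβμc]
      linarith only [h3, h4, h5, h6]
    · have hmem : x ∈ closure (cube n) ∩ {x | r₀ ≤ ‖x‖} := ⟨hxc, not_lt.1 hxr⟩
      have h3 : g x ≤ -c₂ := by
        have h4 := hmV x hmem
        have h5 := hφφ x hmem
        have h6 : 2 * (m - a) ≤ 2 * max (V x - a) 0 := by
          have := le_max_left (V x - a) 0
          linarith
        have h7 : φ₀ * ε' ≤ φ x * (1 - V x) := by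
          have : 0 ≤ φ x := hφ₀.le.trans h5
          have : ε' ≤ 1 - V x := by linarith
          gcongr
        have h8 : c₂ ≤ 2 * max (V x - a) 0 * (φ x * (1 - V x)) := by
          simp only [c₂]
          gcongr
        simp only [g]
        linarith
      have h4 : μ * fderiv ℝ (quadForm P) x (f x) ≤ c₂ / 4 := by
        refine le_trans ?_ hμN₁
        exact mul_le_mul_of_nonneg_left ((le_abs_self _).trans (hN₁ x hxc)) hμ.le
      have h5 : β * ‖x‖ ^ 2 ≤ c₂ / 2 :=
        (mul_le_mul_of_nonneg_left (hnorm x hxc) hβ.le).trans hβc₂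
      linarith only [h1.2, h3, h4, h5, hδc₂]
  have hWlev : ∀ x ∈ closure (cube n), W x < ℓ + β → V x ≤ 1 - ε' := by
    intro x hx hWx
    by_contra! h
    have h1 := hαmono h.le
    have h2 := abs_le.1 (hUv x hx).1
    have h4 := hQ0 x
    have h5 : 0 ≤ μ * quadForm P x :=
      mul_nonneg hμ.le ((by positivity : (0 : ℝ) ≤ 1 / 2 * ‖x‖ ^ 2).trans h4)
    simp only [hW] at hWx
    simp only [v] at h2
    linarith [h2.1]
  have hWsub : ∀ x ∈ cube n, V x ≤ 1 - ε → W x ≤ ℓ - β := by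
    intro x hx hVx
    have hxc := subset_closure hx
    have h1 := hαmono hVx
    have h2 := abs_le.1 (hUv x hxc).1
    have h4 : μ * quadForm P x ≤ d / 4 := by
      refine le_trans ?_ hμN₂
      exact mul_le_mul_of_nonneg_left ((le_abs_self _).trans (hN₂ x hxc)) hμ.le
    simp only [v] at h2
    simp only [hW]
    linarith [h2.2]
  obtain ⟨κ, hκ, hE⟩ := exists_perturbation_bound (W := W) (β := β) (ℓ := ℓ) (ε := ε) (ε' := ε')
    hf.continuous hV1
    ((contDiff_const.mul ((contDiff_quadForm P).of_le (by simp))).add (hU.of_le (by simp)))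
    (by simp [hW, hU0 0 (by simpa using hρ), quadForm]) hβ hℓpos hε' hWpos hWdec hWlev hWsub
  refine ⟨(ℓ⁻¹ * μ) • P, ?_, ?_, fun x => ℓ⁻¹ * U x, contDiff_const.mul hU, hUc.mul_left,
    ⟨ρ, hρ, fun x hx => by simp [hU0 x hx]⟩, κ, hκ, fun E hEs hEb => ?_⟩
  · refine Matrix.PosDef.of_dotProduct_mulVec_pos ?_ fun x hx => ?_
    · rw [Matrix.IsHermitian, Matrix.conjTranspose_eq_transpose_of_trivial,
        Matrix.transpose_smul, hPt]
    · rw [star_trivial, Matrix.smul_mulVec, dotProduct_smul, smul_eq_mul]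
      exact mul_pos (by positivity) ((hdot x hx).trans_le (hP1 x))
  · refine Matrix.PosDef.of_dotProduct_mulVec_pos ?_ fun x hx => ?_
    · rw [Matrix.IsHermitian, Matrix.conjTranspose_eq_transpose_of_trivial]
      simp [Matrix.transpose_mul, hPt, add_comm]
    · rw [star_trivial, Matrix.mul_smul, Matrix.smul_mul, ← smul_add, ← smul_neg,
        Matrix.smul_mulVec, dotProduct_smul, smul_eq_mul, Matrix.neg_mulVec, dotProduct_neg]
      refine mul_pos (by positivity) ?_
      have h1 := hPA x
      have h2 := mul_pos hc (hdot x hx)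
      linarith only [h1, h2]
  · have hGeq : (fun x => quadForm ((ℓ⁻¹ * μ) • P) x + ℓ⁻¹ * U x + E x)
        = fun x => ℓ⁻¹ * W x + E x := by
      ext x
      rw [quadForm_smul, hW]
      ring
    rw [hGeq]
    exact hE E hEs hEb

/-! ### Nonvanishing derivatives of smooth bounded functions -/

lemma exists_polynomial_derivative_eq (q : Polynomial ℝ) :
    ∃ p : Polynomial ℝ, p.derivative = q := by
  induction q using Polynomial.induction_on' with
  | add p q hp hq =>
    obtain ⟨p', rfl⟩ := hp
    obtain ⟨q', rfl⟩ := hq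
    exact ⟨p' + q', Polynomial.derivative_add⟩
  | monomial k a =>
    refine ⟨Polynomial.monomial (k + 1) (a / (k + 1)), ?_⟩
    rw [Polynomial.derivative_monomial]
    congr 1
    push_cast
    field_simp

lemma exists_polynomial_of_iteratedDeriv_eq_zero (k : ℕ) :
    ∀ g : ℝ → ℝ, ContDiff ℝ ∞ g → (∀ t, iteratedDeriv k g t = 0) →
      ∃ p : Polynomial ℝ, ∀ t, g t = p.eval t := by
  induction k with
  | zero => exact fun g _ h => ⟨0, fun t => by simpa using h t⟩
  | succ k ih =>
    intro g hg h
    have hd : ContDiff ℝ ∞ (deriv g) := ((contDiff_infty_iff_deriv).1 hg).2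
    obtain ⟨q, hq⟩ := ih (deriv g) hd fun t => by rw [← iteratedDeriv_succ']; exact h t
    obtain ⟨p, rfl⟩ := exists_polynomial_derivative_eq q
    have hgd : Differentiable ℝ g := hg.differentiable (by simp)
    have hconst := is_const_of_deriv_eq_zero (f := fun t => g t - p.eval t)
      (hgd.sub p.differentiable) fun t => by
        rw [deriv_fun_sub (hgd t) p.differentiableAt, hq, Polynomial.deriv, sub_self]
    refine ⟨p + Polynomial.C (g 0 - p.eval 0), fun t => ?_⟩
    have := hconst t 0
    simp only [Polynomial.eval_add, Polynomial.eval_C]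
    linarith

lemma exists_iteratedDeriv_ne_zero {Ψ : ℝ → ℝ} (hΨ : ContDiff ℝ ∞ Ψ)
    (hb : ∃ C, ∀ t, |Ψ t| ≤ C) (hnc : ∃ s t, Ψ s ≠ Ψ t) (k : ℕ) :
    ∃ b, iteratedDeriv k Ψ b ≠ 0 := by
  by_contra! h
  obtain ⟨p, hp⟩ := exists_polynomial_of_iteratedDeriv_eq_zero k Ψ hΨ h
  obtain ⟨C, hC⟩ := hb
  obtain ⟨s, t, hst⟩ := hnc
  rcases lt_or_ge 0 p.degree with hdeg | hdeg
  · obtain ⟨u, hu⟩ := ((p.abs_tendsto_atTop hdeg).eventually_gt_atTop C).exists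
    rw [← hp] at hu
    linarith [hC u]
  · rw [hp, hp, Polynomial.eq_C_of_degree_le_zero hdeg] at hst
    simp at hst

/-! ### Approximation of one-jets by shallow networks -/

instance : CompactSpace (closure (cube n)) := isCompact_iff_compactSpace.1 isCompact_closure_cube

/-- Continuous maps into a normed group. The target carries the topology of its norm by definition,
so that the supremum norm on a space of maps into the dual of `State n` is found by unification. -/
abbrev NormedMaps (X F : Type*) [TopologicalSpace X] [NormedAddCommGroup F] : Type _ := C(X, F)

/-- The space of pairs of a function and a candidate gradient on the closed cube, with the supremum
norm. Convergence of one-jets in this space is convergence in `C¹`. -/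
abbrev JetSpace (n : ℕ) : Type := NormedMaps (closure (cube n)) (ℝ × (State n →L[ℝ] ℝ))

/-- The one-jet of a `C¹` function on the closed cube. -/
noncomputable def jet (h : State n → ℝ) (hh : ContDiff ℝ 1 h) : JetSpace n where
  toFun x := (h x, fderiv ℝ h x)
  continuous_toFun := by
    have := hh.continuous_fderiv one_ne_zero
    have := hh.continuous
    fun_prop

/-- The pair `(p ⟪w, x⟫, q ⟪w, x⟫ • ⟪w, ·⟫)`. For `q = p'` it is the one-jet of the ridge function
`x ↦ p ⟪w, x⟫`. -/
noncomputable def ridge (w : State n) (p q : C(ℝ, ℝ)) : JetSpace n where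
  toFun x := (p (inner ℝ w (x : State n)), q (inner ℝ w (x : State n)) • innerSL ℝ w)
  continuous_toFun := by fun_prop

lemma hasFDerivAt_ridge (w : State n) {p : ℝ → ℝ} {p' : ℝ} (x : State n)
    (hp : HasDerivAt p p' (inner ℝ w x)) :
    HasFDerivAt (fun x : State n => p (inner ℝ w x)) (p' • innerSL ℝ w) x :=
  hp.comp_hasFDerivAt x (innerSL ℝ w).hasFDerivAt

lemma ridge_add (w : State n) (p q p' q' : C(ℝ, ℝ)) :
    ridge w (p + p') (q + q') = ridge w p q + ridge w p' q' := by
  ext x <;> simp [ridge, add_mul]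

lemma ridge_smul (w : State n) (a : ℝ) (p q : C(ℝ, ℝ)) :
    ridge w (a • p) (a • q) = a • ridge w p q := by
  ext x <;> simp [ridge, mul_assoc]

/-- A curve of continuous functions on a compact space is differentiable as soon as it is so
pointwise, with a derivative that depends continuously on the parameter for the supremum norm. -/
lemma hasDerivAt_of_pointwise {X F : Type*} [TopologicalSpace X] [CompactSpace X]
    [NormedAddCommGroup F] [NormedSpace ℝ F] [CompleteSpace F] {G G' : ℝ → C(X, F)}
    (hG' : Continuous G') (h : ∀ s x, HasDerivAt (fun s => G s x) (G' s x) s) (s : ℝ) :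
    HasDerivAt G (G' s) s := by
  have hG : G = fun s => G 0 + ∫ σ in (0 : ℝ)..s, G' σ := by
    ext s x
    have h1 : (∫ σ in (0 : ℝ)..s, G' σ) x = ∫ σ in (0 : ℝ)..s, G' σ x :=
      ((ContinuousMap.evalCLM ℝ x).intervalIntegral_comp_comm
        (hG'.intervalIntegrable 0 s)).symm
    have hc : Continuous fun σ => G' σ x := (ContinuousMap.evalCLM ℝ x).continuous.comp hG'
    rw [ContinuousMap.add_apply, h1,
      intervalIntegral.integral_eq_sub_of_hasDerivAt (fun σ _ => h σ x)
        (hc.intervalIntegrable 0 s)]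
    abel
  rw [hG]
  exact (intervalIntegral.integral_hasDerivAt_right (hG'.intervalIntegrable 0 s)
    (hG'.stronglyMeasurableAtFilter _ _) hG'.continuousAt).const_add _

lemma mem_of_hasDerivAt {F : Type*} [NormedAddCommGroup F] [NormedSpace ℝ F] {S : Submodule ℝ F}
    (hS : IsClosed (S : Set F)) {G : ℝ → F} (hG : ∀ s, G s ∈ S) {G' : F} {s : ℝ}
    (h : HasDerivAt G G' s) : G' ∈ S := by
  refine hS.mem_of_tendsto (hasDerivAt_iff_tendsto_slope.1 h) (Eventually.of_forall fun t => ?_)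
  rw [slope_def_module]
  exact S.smul_mem _ (S.sub_mem (hG t) (hG s))

/-- The one-jet of `x ↦ tᵏ Ψ⁽ᵏ⁾(s t + b)` at `t = ⟪w, x⟫`, in terms of the derivatives of `Ψ`. -/
noncomputable def ridgeDeriv {Ψ : ℝ → ℝ} (hΨ : ContDiff ℝ ∞ Ψ) (w : State n) (b : ℝ) (k : ℕ)
    (s : ℝ) : JetSpace n :=
  have hc := fun k => hΨ.continuous_iteratedDeriv k (by exact_mod_cast le_top)
  ridge w ⟨fun t => t ^ k * iteratedDeriv k Ψ (s * t + b), by have := hc k; fun_prop⟩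
    ⟨fun t => k * t ^ (k - 1) * iteratedDeriv k Ψ (s * t + b)
      + t ^ k * (s * iteratedDeriv (k + 1) Ψ (s * t + b)), by
        have := hc k; have := hc (k + 1); fun_prop⟩

/-- Differentiating with respect to the weight `s` raises the power of `⟪w, x⟫` by one. -/
lemma hasDerivAt_ridgeDeriv {Ψ : ℝ → ℝ} (hΨ : ContDiff ℝ ∞ Ψ) (w : State n) (b : ℝ) (k : ℕ)
    (s : ℝ) : HasDerivAt (ridgeDeriv hΨ w b k) (ridgeDeriv hΨ w b (k + 1) s) s := by
  have hc := fun k => hΨ.continuous_iteratedDeriv k (by exact_mod_cast le_top)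
  refine hasDerivAt_of_pointwise (G' := ridgeDeriv hΨ w b (k + 1)) ?_ (fun s x => ?_) s
  · refine ContinuousMap.continuous_of_continuous_uncurry _ ?_
    have h1 := hc (k + 1)
    have h2 := hc (k + 1 + 1)
    simp only [ridgeDeriv, ridge, ContinuousMap.coe_mk, Function.uncurry_def]
    fun_prop
  · have hd : ∀ j t, HasDerivAt (fun s => iteratedDeriv j Ψ (s * t + b))
        (t * iteratedDeriv (j + 1) Ψ (s * t + b)) s := by
      intro j t
      have h1 : HasDerivAt (iteratedDeriv j Ψ) (iteratedDeriv (j + 1) Ψ (s * t + b))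
          (s * t + b) := by
        rw [iteratedDeriv_succ]
        exact ((hΨ.differentiable_iteratedDeriv j (by exact_mod_cast ENat.natCast_lt_top j))
          _).hasDerivAt
      have h2 : HasDerivAt (fun s => s * t + b) t s := by
        simpa using ((hasDerivAt_id s).mul_const t).add_const b
      rw [mul_comm]
      exact h1.comp s h2
    set t := inner ℝ w (x : State n)
    have h1 := (hd k t).const_mul (t ^ k)
    have h2 := ((hd k t).const_mul (k * t ^ (k - 1))).add
      (((hasDerivAt_id s).mul (hd (k + 1) t)).const_mul (t ^ k))
    refine HasDerivAt.prodMk ?_ ?_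
    · convert! h1 using 1
      change t ^ (k + 1) * iteratedDeriv (k + 1) Ψ (s * t + b) = _
      ring
    · convert! h2.smul_const (innerSL ℝ w) using 1
      change (((k + 1 : ℕ) : ℝ) * t ^ (k + 1 - 1) * iteratedDeriv (k + 1) Ψ (s * t + b)
        + t ^ (k + 1) * (s * iteratedDeriv (k + 1 + 1) Ψ (s * t + b))) • innerSL ℝ w = _
      congr 1
      rcases k with _ | k
      · simp; ring
      · simp [pow_succ]; ring

lemma contDiff_neuron {Ψ : ℝ → ℝ} (hΨ : ContDiff ℝ ∞ Ψ) (q : State n × ℝ) :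
    ContDiff ℝ 1 fun x : State n => Ψ (inner ℝ q.1 x + q.2) :=
  (hΨ.of_le (by simp)).comp ((contDiff_const.inner ℝ contDiff_id).add contDiff_const)

/-- The closed linear span, in the `C¹` topology on the closed cube, of the one-jets of neurons. -/
noncomputable def neuronSpan (n : ℕ) {Ψ : ℝ → ℝ} (hΨ : ContDiff ℝ ∞ Ψ) :
    Submodule ℝ (JetSpace n) :=
  (Submodule.span ℝ (range fun q : State n × ℝ => jet _ (contDiff_neuron hΨ q))).topologicalClosure

lemma isClosed_neuronSpan {Ψ : ℝ → ℝ} (hΨ : ContDiff ℝ ∞ Ψ) :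
    IsClosed (neuronSpan n hΨ : Set (JetSpace n)) :=
  Submodule.isClosed_topologicalClosure _

lemma ridgeDeriv_mem {Ψ : ℝ → ℝ} (hΨ : ContDiff ℝ ∞ Ψ) (w : State n) (b : ℝ) (k : ℕ) :
    ∀ s, ridgeDeriv hΨ w b k s ∈ neuronSpan n hΨ := by
  induction k with
  | zero =>
    intro s
    refine Submodule.le_topologicalClosure _ (Submodule.subset_span ⟨(s • w, b), ?_⟩)
    ext1 x
    have h1 : HasDerivAt Ψ (deriv Ψ (s * inner ℝ w (x : State n) + b))
        (s * inner ℝ w (x : State n) + b) := (hΨ.differentiable (by simp) _).hasDerivAt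
    have h2 : HasDerivAt (fun t => Ψ (s * t + b)) (s * deriv Ψ (s * inner ℝ w (x : State n) + b))
        (inner ℝ w (x : State n)) := by
      have := h1.comp (h := fun t => s * t + b) (inner ℝ w (x : State n))
        (((hasDerivAt_id (inner ℝ w (x : State n))).const_mul s).add_const b)
      simpa [mul_comm, Function.comp_def] using this
    have h3 := (hasFDerivAt_ridge w (x : State n) h2).fderiv
    simp only [jet, ridgeDeriv, ridge, ContinuousMap.coe_mk, real_inner_smul_left,
      iteratedDeriv_zero, pow_zero, one_mul, zero_add, iteratedDeriv_one, h3]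
    simp
  | succ k ih =>
    exact fun s => mem_of_hasDerivAt (isClosed_neuronSpan hΨ) ih (hasDerivAt_ridgeDeriv hΨ w b k s)

/-- The closed span contains the ridge polynomials: the powers of `⟪w, x⟫` are derivatives of
`Ψ (s ⟪w, x⟫ + b)` with respect to the weight at `s = 0`, up to the factors `Ψ⁽ᵏ⁾ b`, which are
nonzero for suitable `b` since `Ψ` is not a polynomial. -/
lemma ridge_polynomial_mem {Ψ : ℝ → ℝ} (hΨ : ContDiff ℝ ∞ Ψ) (hb : ∃ C, ∀ t, |Ψ t| ≤ C)
    (hnc : ∃ s t, Ψ s ≠ Ψ t) (w : State n) (p : Polynomial ℝ) :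
    ridge w p.toContinuousMap p.derivative.toContinuousMap ∈ neuronSpan n hΨ := by
  induction p using Polynomial.induction_on' with
  | add p q hp hq =>
    have h1 : ridge w (p + q).toContinuousMap (p + q).derivative.toContinuousMap
        = ridge w p.toContinuousMap p.derivative.toContinuousMap
          + ridge w q.toContinuousMap q.derivative.toContinuousMap := by
      rw [← ridge_add]
      congr 1 <;> ext t <;> simp
    rw [h1]
    exact Submodule.add_mem _ hp hq
  | monomial k a =>
    obtain ⟨b, hbk⟩ := exists_iteratedDeriv_ne_zero hΨ hb hnc k
    have h1 : ridge w (Polynomial.monomial k a).toContinuousMap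
        (Polynomial.monomial k a).derivative.toContinuousMap
        = (a / iteratedDeriv k Ψ b) • ridgeDeriv hΨ w b k 0 := by
      rw [ridgeDeriv, ← ridge_smul]
      congr 1 <;> ext t <;> simp [Polynomial.derivative_monomial] <;> field_simp
    rw [h1]
    exact Submodule.smul_mem _ _ (ridgeDeriv_mem hΨ w b k 0)

/-- The closed span contains every `C¹` ridge function, by Weierstrass' theorem for the derivative
of its profile. -/
lemma ridge_mem {Ψ : ℝ → ℝ} (hΨ : ContDiff ℝ ∞ Ψ) (hb : ∃ C, ∀ t, |Ψ t| ≤ C)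
    (hnc : ∃ s t, Ψ s ≠ Ψ t) (w : State n) (g g' : C(ℝ, ℝ)) (hg : ∀ t, HasDerivAt g (g' t) t) :
    ridge w g g' ∈ neuronSpan n hΨ := by
  rw [← SetLike.mem_coe, ← (isClosed_neuronSpan hΨ).closure_eq, Metric.mem_closure_iff]
  intro ε hε
  -- The scalar products `⟪w, x⟫` range over an interval `[-M, M]`.
  set M : ℝ := ‖w‖ * √n
  have hM : 0 ≤ M := by positivity
  have hin : ∀ x ∈ closure (cube n), inner ℝ w x ∈ Icc (-M) M := fun x hx =>
    abs_le.1 ((abs_real_inner_le_norm w x).trans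
      (mul_le_mul_of_nonneg_left (norm_le_of_mem_closure_cube hx) (norm_nonneg w)))
  set η := ε / (2 * (M + ‖w‖ + 1))
  have hη : 0 < η := by positivity
  have hηε : η * (M + ‖w‖ + 1) = ε / 2 := by simp only [η]; field_simp
  obtain ⟨q, hq⟩ := exists_polynomial_near_continuousMap (-M) M (g'.restrict (Icc (-M) M)) η hη
  have hq' : ∀ t ∈ Icc (-M) M, |q.eval t - g' t| ≤ η := by
    intro t ht
    have := (ContinuousMap.norm_coe_le_norm _ (⟨t, ht⟩ : Icc (-M) M)).trans hq.le
    simpa using this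
  obtain ⟨p₀, hp₀⟩ := exists_polynomial_derivative_eq q
  set p := p₀ + Polynomial.C (g 0 - p₀.eval 0)
  have hpd : p.derivative = q := by simp [p, hp₀]
  have hp0 : p.eval 0 = g 0 := by simp [p]
  have hpg : ∀ t ∈ Icc (-M) M, |p.eval t - g t| ≤ η * M := by
    intro t ht
    have h1 := (convex_Icc (-M) M).norm_image_sub_le_of_norm_hasDerivWithin_le
      (f := fun t => p.eval t - g t) (f' := fun t => q.eval t - g' t) (C := η) (x := 0) (y := t)
      (fun s _ => by
        have h2 := (p.hasDerivAt s).sub (hg s)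
        rw [hpd] at h2
        exact h2.hasDerivWithinAt) hq' ⟨by linarith, hM⟩ ht
    simp only [hp0, sub_self, sub_zero, Real.norm_eq_abs] at h1
    exact h1.trans (mul_le_mul_of_nonneg_left (abs_le.2 ht) hη.le)
  refine ⟨_, ridge_polynomial_mem hΨ hb hnc w p, ?_⟩
  rw [dist_comm, dist_eq_norm]
  refine lt_of_le_of_lt ((ContinuousMap.norm_le _ (half_pos hε).le).2 fun x => ?_)
    (half_lt_self hε)
  have hx := hin x x.2
  set t := inner ℝ w (x : State n)
  have h1 : (ridge w p.toContinuousMap p.derivative.toContinuousMap - ridge w g g') x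
      = (p.eval t - g t, (q.eval t - g' t) • innerSL ℝ w) := by
    rw [hpd]
    simp [ridge, sub_smul, t]
  rw [h1, Prod.norm_def, norm_smul, innerSL_apply_norm]
  refine max_le ((hpg t hx).trans ?_) ?_
  · nlinarith [norm_nonneg w]
  · have := mul_le_mul_of_nonneg_right (hq' t hx) (norm_nonneg w)
    rw [Real.norm_eq_abs]
    nlinarith [norm_nonneg w]

lemma integral_mem_of_isClosed {Ω F : Type*} [MeasurableSpace Ω] [TopologicalSpace Ω]
    [OpensMeasurableSpace Ω] [SecondCountableTopology Ω] {μ : Measure Ω} [NormedAddCommGroup F]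
    [NormedSpace ℝ F] [CompleteSpace F] {S : Submodule ℝ F} (hS : IsClosed (S : Set F))
    {G : Ω → F} (hG : ∀ s, G s ∈ S) (hc : Continuous G) (hi : Integrable G μ) :
    ∫ s, G s ∂μ ∈ S := by
  have : CompleteSpace S := hS.completeSpace_coe
  set H : Ω → S := fun s => ⟨G s, hG s⟩
  have hH : Integrable H μ :=
    (integrable_norm_iff (hc.subtype_mk hG).aestronglyMeasurable).1 hi.norm
  have h1 : ∫ s, G s ∂μ = S.subtypeL (∫ s, H s ∂μ) := S.subtypeL.integral_comp_comm hH
  rw [h1]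
  exact (∫ s, H s ∂μ).2

/-- The plane wave `t ↦ Re (c exp (2πit))`. -/
noncomputable def wave (c : ℂ) : C(ℝ, ℝ) where
  toFun t := (Complex.exp (↑(2 * Real.pi * t) * Complex.I) * c).re
  continuous_toFun := by fun_prop

lemma hasDerivAt_wave (c : ℂ) (t : ℝ) :
    HasDerivAt (wave c) (wave (2 * Real.pi * Complex.I * c) t) t := by
  have h1 : HasDerivAt (fun t : ℝ => (↑(2 * Real.pi * t) : ℂ) * Complex.I)
      (2 * Real.pi * Complex.I) t := by
    have := ((((hasDerivAt_id t).const_mul (2 * Real.pi)).ofReal_comp).mul_const Complex.I)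
    simpa using this
  have h2 : HasDerivAt (fun t : ℝ => Complex.exp (↑(2 * Real.pi * t) * Complex.I) * c)
      (Complex.exp (↑(2 * Real.pi * t) * Complex.I) * (2 * Real.pi * Complex.I * c)) t := by
    have := (h1.cexp).mul_const c
    rwa [mul_assoc] at this
  exact Complex.reCLM.hasFDerivAt.comp_hasDerivAt t h2

lemma abs_wave_le (c : ℂ) (t : ℝ) : |wave c t| ≤ ‖c‖ := by
  refine (Complex.abs_re_le_norm _).trans ?_
  rw [norm_mul, Complex.norm_exp_ofReal_mul_I, one_mul]

/-- Fourier inversion writes a smooth compactly supported function as an integral of ridge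
functions that converges in `C¹`. -/
theorem jet_mem_neuronSpan {Ψ : ℝ → ℝ} (hΨ : ContDiff ℝ ∞ Ψ) (hb : ∃ C, ∀ t, |Ψ t| ≤ C)
    (hnc : ∃ s t, Ψ s ≠ Ψ t) {r : State n → ℝ} (hr : ContDiff ℝ ∞ r) (hrc : HasCompactSupport r) :
    jet r (hr.of_le (by simp)) ∈ neuronSpan n hΨ := by
  have hrC : ContDiff ℝ ∞ fun x => (r x : ℂ) := Complex.ofRealCLM.contDiff.comp hr
  have hrCc : HasCompactSupport fun x => (r x : ℂ) :=
    hrc.comp_left (g := fun t : ℝ => (t : ℂ)) Complex.ofReal_zero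
  set R : SchwartzMap (State n) ℂ := hrCc.toSchwartzMap hrC
  set Q : SchwartzMap (State n) ℂ := FourierTransform.fourier R
  have hinv : ∀ x, (r x : ℂ)
      = ∫ ξ, Complex.exp (↑(2 * Real.pi * inner ℝ ξ x) * Complex.I) * Q ξ := by
    intro x
    have h1 : FourierTransformInv.fourierInv (FourierTransform.fourier (R : State n → ℂ)) = R :=
      R.continuous.fourierInv_fourier_eq R.integrable
        (by rw [← SchwartzMap.fourier_coe]; exact SchwartzMap.integrable _)
    have h2 := congrFun h1 x
    rw [Real.fourierInv_eq'] at h2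
    exact h2.symm
  have hQ0 : Integrable fun ξ => ‖Q ξ‖ := Q.integrable.norm
  have hQ1 : Integrable fun ξ => ‖ξ‖ * ‖Q ξ‖ := by
    simpa using Q.integrable_pow_mul volume 1
  have hQc : Continuous Q := Q.continuous
  set G : State n → JetSpace n := fun ξ =>
    ridge ξ (wave (Q ξ)) (wave (2 * Real.pi * Complex.I * Q ξ))
  have hGmem : ∀ ξ, G ξ ∈ neuronSpan n hΨ := fun ξ =>
    ridge_mem hΨ hb hnc ξ _ _ (hasDerivAt_wave (Q ξ))
  have hGc : Continuous G := by
    refine ContinuousMap.continuous_of_continuous_uncurry _ ?_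
    have h1 : Continuous fun z : State n × closure (cube n) =>
        ((Complex.exp (↑(2 * Real.pi * inner ℝ z.1 (z.2 : State n)) * Complex.I) * Q z.1).re,
          (Complex.exp (↑(2 * Real.pi * inner ℝ z.1 (z.2 : State n)) * Complex.I)
            * (2 * Real.pi * Complex.I * Q z.1)).re • innerSL ℝ z.1) := by fun_prop
    exact h1
  have hbound : ∀ ξ t, ‖wave (2 * Real.pi * Complex.I * Q ξ) t • innerSL ℝ ξ‖
      ≤ 2 * Real.pi * (‖ξ‖ * ‖Q ξ‖) := by
    intro ξ t
    rw [norm_smul, innerSL_apply_norm, Real.norm_eq_abs]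
    have h1 := abs_wave_le (2 * Real.pi * Complex.I * Q ξ) t
    have h2 : ‖2 * Real.pi * Complex.I * Q ξ‖ = 2 * Real.pi * ‖Q ξ‖ := by
      simp [abs_of_pos Real.pi_pos]
    rw [h2] at h1
    calc |wave (2 * Real.pi * Complex.I * Q ξ) t| * ‖ξ‖ ≤ 2 * Real.pi * ‖Q ξ‖ * ‖ξ‖ := by gcongr
      _ = 2 * Real.pi * (‖ξ‖ * ‖Q ξ‖) := by ring
  have hGi : Integrable G := by
    refine Integrable.mono' (hQ0.add (hQ1.const_mul (2 * Real.pi))) hGc.aestronglyMeasurable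
      (ae_of_all _ fun ξ => ?_)
    have hnn : 0 ≤ 2 * Real.pi * (‖ξ‖ * ‖Q ξ‖) := by positivity
    refine (ContinuousMap.norm_le _ (add_nonneg (norm_nonneg _) hnn)).2 fun x => ?_
    refine max_le ((abs_wave_le _ _).trans (le_add_of_nonneg_right hnn)) ?_
    exact (hbound ξ _).trans (le_add_of_nonneg_left (norm_nonneg _))
  have hint : ∫ ξ, G ξ = jet r (hr.of_le (by simp)) := by
    ext1 x
    have hGx : Integrable fun ξ => G ξ x := (ContinuousMap.evalCLM ℝ x).integrable_comp hGi
    rw [ContinuousMap.integral_apply hGi]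
    have hrx : ∀ x : State n, r x = ∫ ξ, wave (Q ξ) (inner ℝ ξ x) := by
      intro x
      have hi : Integrable fun ξ =>
          Complex.exp (↑(2 * Real.pi * inner ℝ ξ x) * Complex.I) * Q ξ := by
        refine Integrable.mono' hQ0 (by fun_prop) (ae_of_all _ fun ξ => ?_)
        rw [norm_mul, Complex.norm_exp_ofReal_mul_I, one_mul]
      have h1 := congrArg Complex.re (hinv x)
      rw [Complex.ofReal_re] at h1
      rw [h1]
      exact (Complex.reCLM.integral_comp_comm hi).symm
    have hder : HasFDerivAt r (∫ ξ, wave (2 * Real.pi * Complex.I * Q ξ)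
        (inner ℝ ξ (x : State n)) • innerSL ℝ ξ) x := by
      rw [funext hrx]
      refine hasFDerivAt_integral_of_dominated_of_fderiv_le
        (F' := fun x ξ => wave (2 * Real.pi * Complex.I * Q ξ) (inner ℝ ξ x) • innerSL ℝ ξ)
        (bound := fun ξ => 2 * Real.pi * (‖ξ‖ * ‖Q ξ‖)) univ_mem
        (Eventually.of_forall fun y => ?_) ?_ ?_ (ae_of_all _ fun ξ y _ => hbound ξ _)
        (hQ1.const_mul _)
        (ae_of_all _ fun ξ y _ => hasFDerivAt_ridge ξ y (hasDerivAt_wave (Q ξ) _))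
      · have h1 : Continuous fun ξ : State n =>
            (Complex.exp (↑(2 * Real.pi * inner ℝ ξ y) * Complex.I) * Q ξ).re := by fun_prop
        exact h1.aestronglyMeasurable
      · exact hGx.fst
      · exact hGx.snd.aestronglyMeasurable
    refine Prod.ext ?_ ?_
    · rw [fst_integral hGx]
      exact (hrx x).symm
    · rw [snd_integral hGx]
      exact hder.fderiv.symm
  rw [← hint]
  exact integral_mem_of_isClosed (isClosed_neuronSpan hΨ) hGmem hGc hGi

/-- Universal approximation in `C¹` on the closed cube by networks with one hidden layer. -/
theorem exists_network_approx {Ψ : ℝ → ℝ} (hΨ : ContDiff ℝ ∞ Ψ) (hb : ∃ C, ∀ t, |Ψ t| ≤ C)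
    (hnc : ∃ s t, Ψ s ≠ Ψ t) {r : State n → ℝ} (hr : ContDiff ℝ ∞ r) (hrc : HasCompactSupport r)
    {ε : ℝ} (hε : 0 < ε) :
    ∃ c : State n × ℝ →₀ ℝ, ∀ x ∈ closure (cube n),
      |(∑ q ∈ c.support, c q * Ψ (inner ℝ q.1 x + q.2)) - r x| ≤ ε ∧
      ‖fderiv ℝ (fun x => (∑ q ∈ c.support, c q * Ψ (inner ℝ q.1 x + q.2)) - r x) x‖ ≤ ε := by
  have hmem := jet_mem_neuronSpan hΨ hb hnc hr hrc
  rw [neuronSpan, ← SetLike.mem_coe, Submodule.topologicalClosure_coe, Metric.mem_closure_iff]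
    at hmem
  obtain ⟨u, hu, hdist⟩ := hmem ε hε
  obtain ⟨c, rfl⟩ := Finsupp.mem_span_range_iff_exists_finsupp.1 hu
  refine ⟨c, fun x hx => ?_⟩
  rw [dist_comm, dist_eq_norm] at hdist
  have h1 := (ContinuousMap.norm_coe_le_norm _ (⟨x, hx⟩ : closure (cube n))).trans hdist.le
  have h2 : HasFDerivAt (fun x => (∑ q ∈ c.support, c q * Ψ (inner ℝ q.1 x + q.2)) - r x)
      ((∑ q ∈ c.support, c q • fderiv ℝ (fun x => Ψ (inner ℝ q.1 x + q.2)) x) - fderiv ℝ r x)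
      x := by
    refine HasFDerivAt.sub (HasFDerivAt.fun_sum fun q _ => ?_)
      (hr.differentiable (by simp) x).hasFDerivAt
    exact ((contDiff_neuron hΨ q).differentiable one_ne_zero x).hasFDerivAt.const_mul (c q)
  have h3 : ((c.sum fun q a => a • jet _ (contDiff_neuron hΨ q))
      - jet r (hr.of_le (by simp))) (⟨x, hx⟩ : closure (cube n))
      = ((∑ q ∈ c.support, c q * Ψ (inner ℝ q.1 x + q.2)) - r x,
        (∑ q ∈ c.support, c q • fderiv ℝ (fun x => Ψ (inner ℝ q.1 x + q.2)) x)
          - fderiv ℝ r x) := by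
    rw [ContinuousMap.sub_apply, Finsupp.sum, ContinuousMap.sum_apply]
    refine Prod.ext ?_ ?_
    · simp [jet, Prod.fst_sum]
    · simp [jet, Prod.snd_sum]
  rw [h3] at h1
  rw [h2.fderiv]
  exact ⟨(le_max_left _ _).trans h1, (le_max_right _ _).trans h1⟩

/-! ### Cubic monomials -/

/-- The monomial `∏ k, x_k ^ i_k`. -/
noncomputable def cubicMonomial (i : CubicIndex n) (x : State n) : ℝ := ∏ k, x k ^ (i.1 k : ℕ)

lemma contDiff_cubicMonomial (i : CubicIndex n) : ContDiff ℝ ∞ (cubicMonomial i) := by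
  unfold cubicMonomial
  refine contDiff_prod fun k _ => ContDiff.pow ?_ _
  exact (EuclideanSpace.proj k : State n →L[ℝ] ℝ).contDiff

lemma cubicMonomial_smul (i : CubicIndex n) (t : ℝ) (x : State n) :
    cubicMonomial i (t • x) = t ^ 3 * cubicMonomial i x := by
  simp only [cubicMonomial, PiLp.smul_apply, smul_eq_mul, mul_pow]
  rw [Finset.prod_mul_distrib, Finset.prod_pow_eq_pow_sum, i.2]

lemma fderiv_cubicMonomial_smul (i : CubicIndex n) {t : ℝ} (ht : t ≠ 0) (x : State n) :
    fderiv ℝ (cubicMonomial i) (t • x) = t ^ 2 • fderiv ℝ (cubicMonomial i) x := by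
  have h1 : fderiv ℝ (fun x => cubicMonomial i (t • x)) x
      = t • fderiv ℝ (cubicMonomial i) (t • x) := fderiv_comp_smul t
  have h2 : HasFDerivAt (fun x => t ^ 3 * cubicMonomial i x)
      (t ^ 3 • fderiv ℝ (cubicMonomial i) x) x :=
    ((contDiff_cubicMonomial i).differentiable (by simp) x).hasFDerivAt.const_mul _
  simp only [cubicMonomial_smul] at h1
  rw [h2.fderiv] at h1
  have h3 : t • fderiv ℝ (cubicMonomial i) (t • x)
      = t • (t ^ 2 • fderiv ℝ (cubicMonomial i) x) := by
    rw [← h1, smul_smul]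
    congr 1
    ring
  exact smul_right_injective _ ht h3

/-- By homogeneity, a cubic monomial and its derivative are of second order at the origin. -/
lemma cubicMonomial_bounds (i : CubicIndex n) : ∃ C, 0 ≤ C ∧ ∀ x ∈ closure (cube n),
    |cubicMonomial i x| ≤ C * ‖x‖ ^ 2 ∧ ‖fderiv ℝ (cubicMonomial i) x‖ ≤ C * ‖x‖ ^ 2 := by
  have hm := contDiff_cubicMonomial i
  have hK := isCompact_closedBall (0 : State n) 1
  obtain ⟨C₁, hC₁⟩ := hK.exists_bound_of_continuousOn hm.continuous.continuousOn
  obtain ⟨C₂, hC₂⟩ := hK.exists_bound_of_continuousOn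
    (hm.continuous_fderiv (by simp)).continuousOn
  have h0 : (0 : State n) ∈ closedBall (0 : State n) 1 := by simp
  have hC₁0 := (norm_nonneg _).trans (hC₁ 0 h0)
  have hC₂0 := (norm_nonneg _).trans (hC₂ 0 h0)
  refine ⟨C₁ * √n + C₂, by positivity, fun x hx => ?_⟩
  have hgen : ∀ y : State n, y ≠ 0 → |cubicMonomial i y| ≤ C₁ * ‖y‖ ^ 3 ∧
      ‖fderiv ℝ (cubicMonomial i) y‖ ≤ C₂ * ‖y‖ ^ 2 := by
    intro y hy
    have hny : 0 < ‖y‖ := norm_pos_iff.2 hy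
    set u := ‖y‖⁻¹ • y with hu
    have hyu : y = ‖y‖ • u := (smul_inv_smul₀ hny.ne' y).symm
    have hub : u ∈ closedBall (0 : State n) 1 := by
      rw [mem_closedBall_zero_iff, hu, norm_smul, norm_inv, norm_norm, inv_mul_cancel₀ hny.ne']
    constructor
    · have h1 : cubicMonomial i y = ‖y‖ ^ 3 * cubicMonomial i u := by
        conv_lhs => rw [hyu]
        exact cubicMonomial_smul i _ _
      rw [h1, abs_mul, abs_of_pos (by positivity), mul_comm]
      exact mul_le_mul_of_nonneg_right (hC₁ u hub) (by positivity)
    · have h1 : fderiv ℝ (cubicMonomial i) y = ‖y‖ ^ 2 • fderiv ℝ (cubicMonomial i) u := by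
        conv_lhs => rw [hyu]
        exact fderiv_cubicMonomial_smul i hny.ne' _
      rw [h1, norm_smul, Real.norm_of_nonneg (by positivity), mul_comm]
      exact mul_le_mul_of_nonneg_right (hC₂ u hub) (by positivity)
  have hsq : 0 ≤ ‖x‖ ^ 2 := by positivity
  by_cases hx0 : x = 0
  · subst hx0
    have h1 : cubicMonomial i 0 = 0 := by
      have := cubicMonomial_smul i 0 0
      simpa using this
    -- The derivative vanishes at the origin, by homogeneity of degree two.
    have h2 : fderiv ℝ (cubicMonomial i) 0 = 0 := by
      have h3 := fderiv_cubicMonomial_smul i (two_ne_zero (α := ℝ)) 0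
      rw [smul_zero] at h3
      have h4 : (3 : ℝ) • fderiv ℝ (cubicMonomial i) 0 = 0 := by
        have h5 : (3 : ℝ) • fderiv ℝ (cubicMonomial i) 0
            = (2 : ℝ) ^ 2 • fderiv ℝ (cubicMonomial i) 0 - fderiv ℝ (cubicMonomial i) 0 := by
          module
        rw [h5, ← h3, sub_self]
      exact (smul_eq_zero.1 h4).resolve_left (by norm_num)
    simp [h1, h2]
  · obtain ⟨h1, h2⟩ := hgen x hx0
    have h3 := norm_le_of_mem_closure_cube hx
    constructor
    · have h4 : C₁ * ‖x‖ ^ 3 ≤ C₁ * √n * ‖x‖ ^ 2 := by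
        calc C₁ * ‖x‖ ^ 3 = C₁ * ‖x‖ * ‖x‖ ^ 2 := by ring
          _ ≤ C₁ * √n * ‖x‖ ^ 2 := by gcongr
      nlinarith [mul_nonneg hC₂0 hsq]
    · nlinarith [mul_nonneg (mul_nonneg hC₁0 (Real.sqrt_nonneg n)) hsq]

lemma sum_sq_cubicMonomial_pos {x : State n} (hx : x ≠ 0) :
    0 < ∑ i : CubicIndex n, cubicMonomial i x ^ 2 := by
  obtain ⟨k, hk⟩ : ∃ k, x k ≠ 0 := by
    by_contra! h
    exact hx (by ext k; simpa using h k)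
  have hi : ∑ j, ((if j = k then (3 : Fin 4) else 0 : Fin 4) : ℕ) = 3 := by
    rw [Finset.sum_eq_single k] <;> simp +contextual
  refine lt_of_lt_of_le ?_ (Finset.single_le_sum (fun i _ => sq_nonneg (cubicMonomial i x))
    (Finset.mem_univ (⟨fun j => if j = k then 3 else 0, hi⟩ : CubicIndex n)))
  have h1 : cubicMonomial (⟨fun j => if j = k then 3 else 0, hi⟩ : CubicIndex n) x = x k ^ 3 := by
    rw [cubicMonomial, Finset.prod_eq_single k] <;> simp +contextual
  rw [h1]
  positivity

/-- A smooth compactly supported function that vanishes near the origin is a combination of the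
cubic monomials with smooth compactly supported coefficients: writing `m i` for the monomials, the
coefficients are `U m i / ∑ j, m j ²`, where the denominator vanishes at the origin only. -/
lemma exists_cubic_coefficients {U : State n → ℝ} (hU : ContDiff ℝ ∞ U) (hUc : HasCompactSupport U)
    {ρ : ℝ} (hρ : 0 < ρ) (hU0 : ∀ x, ‖x‖ < ρ → U x = 0) :
    ∃ r : CubicIndex n → State n → ℝ, (∀ i, ContDiff ℝ ∞ (r i)) ∧
      (∀ i, HasCompactSupport (r i)) ∧ ∀ x, U x = ∑ i, r i x * cubicMonomial i x := by
  set S : State n → ℝ := fun x => ∑ i : CubicIndex n, cubicMonomial i x ^ 2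
  have hS : ContDiff ℝ ∞ S := ContDiff.sum fun i _ => (contDiff_cubicMonomial i).pow 2
  refine ⟨fun i x => U x * (cubicMonomial i x / S x), fun i => ?_, fun i => hUc.mul_right,
    fun x => ?_⟩
  · refine contDiff_iff_contDiffAt.2 fun x => ?_
    by_cases hx : x = 0
    · have hev : (fun x => U x * (cubicMonomial i x / S x)) =ᶠ[𝓝 x] fun _ => 0 := by
        have : {x : State n | ‖x‖ < ρ} ∈ 𝓝 x :=
          (isOpen_lt continuous_norm continuous_const).mem_nhds (by simpa [hx] using hρ)
        filter_upwards [this] with y hy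
        rw [hU0 y hy, zero_mul]
      exact contDiffAt_const.congr_of_eventuallyEq hev
    · exact hU.contDiffAt.mul ((contDiff_cubicMonomial i).contDiffAt.div hS.contDiffAt
        (sum_sq_cubicMonomial_pos hx).ne')
  · by_cases hx : x = 0
    · have hUx : U x = 0 := hU0 x (by simpa [hx] using hρ)
      simp [hUx]
    · have hSx : S x ≠ 0 := (sum_sq_cubicMonomial_pos hx).ne'
      have h1 : ∀ i, U x * (cubicMonomial i x / S x) * cubicMonomial i x
          = U x / S x * cubicMonomial i x ^ 2 := fun i => by ring
      simp only [h1]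
      rw [← Finset.mul_sum]
      exact (div_mul_cancel₀ _ hSx).symm

/-! ### Deep networks as shallow networks -/

/-- The activation function of a shallow network that reproduces a deep network whose hidden layers
act on each neuron separately by `t ↦ ψ (s t + β)`. -/
def deepActivation (ψ : ℝ → ℝ) (s β : ℝ) : ℕ → ℝ → ℝ
  | 0 => ψ
  | k + 1 => fun t => ψ (s * deepActivation ψ s β k t + β)

lemma contDiff_deepActivation {ψ : ℝ → ℝ} (hψ : ContDiff ℝ ∞ ψ) (s β : ℝ) (k : ℕ) :
    ContDiff ℝ ∞ (deepActivation ψ s β k) := by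
  induction k with
  | zero => exact hψ
  | succ k ih => exact hψ.comp ((contDiff_const.mul ih).add contDiff_const)

lemma abs_deepActivation_le {ψ : ℝ → ℝ} {C : ℝ} (hψ : ∀ t, |ψ t| ≤ C) (s β : ℝ) (k : ℕ) (t : ℝ) :
    |deepActivation ψ s β k t| ≤ C := by
  cases k <;> exact hψ _

/-- Choosing `s` and `β` such that `s ψ t + β = t` at two points with different values of `ψ` keeps
these two values through all layers, so that the composition is not constant. -/
lemma exists_deepActivation_nonconstant {ψ : ℝ → ℝ} (hψ : ∃ t u, ψ t ≠ ψ u) :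
    ∃ s β : ℝ, ∀ k, ∃ t u, deepActivation ψ s β k t ≠ deepActivation ψ s β k u := by
  obtain ⟨t, u, htu⟩ := hψ
  have hne : ψ t - ψ u ≠ 0 := sub_ne_zero.2 htu
  set s := (t - u) / (ψ t - ψ u) with hs
  have hstu : s * ψ t - s * ψ u = t - u := by
    rw [← mul_sub, hs, div_mul_cancel₀ _ hne]
  have hfix : ∀ v, s * ψ v + (t - s * ψ t) = v →
      ∀ k, deepActivation ψ s (t - s * ψ t) k v = ψ v := by
    intro v hv k
    induction k with
    | zero => rfl
    | succ k ih =>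
      change ψ (s * deepActivation ψ s (t - s * ψ t) k v + (t - s * ψ t)) = ψ v
      rw [ih, hv]
  refine ⟨s, t - s * ψ t, fun k => ⟨t, u, ?_⟩⟩
  rwa [hfix t (by ring), hfix u (by linarith)]

lemma hidden_eq_deepActivation (ψ : ℝ → ℝ) (s β : ℝ) {N L : ℕ} (Θ : Parameters n N L)
    (hW : ∀ j, Θ.W j = s • 1) (hb : ∀ j, Θ.b j = fun _ => β) (x : State n) (k : Fin (L + 1)) :
    hidden ψ Θ x k
      = fun j => deepActivation ψ s β k ((Θ.W₀ *ᵥ x.ofLp + Θ.b₀) j) := by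
  induction k using Fin.induction with
  | zero => rfl
  | succ k ih =>
    have h1 : hidden ψ Θ x k.succ = layer ψ (Θ.W k) (Θ.b k) (hidden ψ Θ x k.castSucc) := rfl
    rw [h1, ih]
    ext j
    simp [layer, hW, hb, deepActivation, Matrix.smul_mulVec]

lemma exists_dual_family {ι : Type*} [Fintype ι] [DecidableEq ι] {m : ℕ} {e : ι → Fin m → ℝ}
    (he : LinearIndependent ℝ e) :
    ∃ d : ι → Fin m → ℝ, ∀ i j, d i ⬝ᵥ e j = if i = j then 1 else 0 := by
  have hker : LinearMap.ker (Fintype.linearCombination ℝ e) = ⊥ :=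
    LinearMap.ker_eq_bot.2 he.fintypeLinearCombination_injective
  obtain ⟨g, hg⟩ := LinearMap.exists_leftInverse_of_injective _ hker
  refine ⟨fun i l => g (Pi.single l 1) i, fun i j => ?_⟩
  have h1 : g (e j) = Pi.single j 1 := by
    have := LinearMap.congr_fun hg (Pi.single j 1)
    simpa using this
  have h2 : g (e j) i = ∑ l, e j l * g (Pi.single l 1) i := by
    conv_lhs => rw [pi_eq_sum_univ' (e j)]
    simp
  rw [dotProduct, Finset.sum_congr rfl fun l _ => mul_comm _ _, ← h2, h1, Pi.single_apply]

/-- Finitely many shallow networks with the composed activation function are the outputs, selected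
by linearly independent vectors, of one deep network. -/
lemma exists_parameters (ψ : ℝ → ℝ) (s β : ℝ) (L : ℕ) {e : CubicIndex n → Fin (n ^ 3) → ℝ}
    (he : LinearIndependent ℝ e) (c : CubicIndex n → State n × ℝ →₀ ℝ) :
    ∃ (N : ℕ) (Θ : Parameters n N L), 0 < N ∧ ∀ x i, residual ψ Θ x ⬝ᵥ e i
      = ∑ q ∈ (c i).support, c i q * deepActivation ψ s β L (inner ℝ q.1 x + q.2) := by
  classical
  obtain ⟨d, hd⟩ := exists_dual_family he
  -- Including `0` makes the width positive.
  set T : Finset (State n × ℝ) := insert 0 (Finset.univ.biUnion fun i => (c i).support)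
  set q : Fin T.card → State n × ℝ := fun j => (T.equivFin.symm j : State n × ℝ)
  set Θ : Parameters n T.card L :=
    { W₀ := fun j k => (q j).1 k
      b₀ := fun j => (q j).2
      W := fun _ => s • 1
      b := fun _ _ => β
      Wout := fun l j => ∑ i, d i l * c i (q j)
      bout := 0 }
  refine ⟨T.card, Θ, Finset.card_pos.2 ⟨0, Finset.mem_insert_self _ _⟩, fun x i => ?_⟩
  set h : State n × ℝ → ℝ := fun q => deepActivation ψ s β L (inner ℝ q.1 x + q.2)
  have hhid : hidden ψ Θ x (Fin.last L) = fun j => h (q j) := by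
    rw [hidden_eq_deepActivation ψ s β Θ (fun _ => rfl) (fun _ => rfl)]
    ext j
    simp only [h, Fin.val_last]
    congr 1
    rw [EuclideanSpace.inner_eq_star_dotProduct, dotProduct_comm]
    rfl
  have h1 : residual ψ Θ x ⬝ᵥ e i = ∑ j, c i (q j) * h (q j) := by
    simp only [residual, hhid, Θ, add_zero, dotProduct, Matrix.mulVec, Finset.sum_mul]
    rw [Finset.sum_comm]
    refine Finset.sum_congr rfl fun j _ => ?_
    have h2 : ∀ l, ∑ i', d i' l * c i' (q j) * h (q j) * e i l
        = ∑ i', c i' (q j) * h (q j) * (d i' l * e i l) :=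
      fun l => Finset.sum_congr rfl fun i' _ => by ring
    simp only [h2]
    rw [Finset.sum_comm]
    have h3 : ∀ i', ∑ l, c i' (q j) * h (q j) * (d i' l * e i l)
        = c i' (q j) * h (q j) * (if i' = i then 1 else 0) := by
      intro i'
      rw [← hd i' i, dotProduct, Finset.mul_sum]
    simp [h3]
  rw [h1]
  have h2 : ∑ j, c i (q j) * h (q j) = ∑ p ∈ T, c i p * h p := by
    rw [← Finset.sum_coe_sort T]
    exact Equiv.sum_comp T.equivFin.symm fun p : T => c i p * h p
  rw [h2]
  refine (Finset.sum_subset (fun p hp => ?_) fun p _ hp => ?_).symm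
  · exact Finset.mem_insert_of_mem (Finset.mem_biUnion.2 ⟨i, Finset.mem_univ _, hp⟩)
  · rw [Finsupp.notMem_support_iff.1 hp, zero_mul]

/-- Combinations of cubic monomials with coefficients that are small in `C¹` are small of second
order at the origin. -/
lemma exists_cubic_perturbation_bound {κ : ℝ} (hκ : 0 < κ) :
    ∃ η > 0, ∀ g : CubicIndex n → State n → ℝ, (∀ i, ContDiff ℝ 1 (g i)) →
      (∀ i, ∀ x ∈ closure (cube n), |g i x| ≤ η ∧ ‖fderiv ℝ (g i) x‖ ≤ η) →
      ContDiff ℝ 1 (fun x => ∑ i, g i x * cubicMonomial i x) ∧ ∀ x ∈ closure (cube n),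
        |∑ i, g i x * cubicMonomial i x| ≤ κ * ‖x‖ ^ 2 ∧
        ‖fderiv ℝ (fun x => ∑ i, g i x * cubicMonomial i x) x‖ ≤ κ * ‖x‖ ^ 2 := by
  choose C hC0 hC using cubicMonomial_bounds (n := n)
  have hpos : ∀ᶠ t : ℝ in 𝓝[>] 0, 0 < t := self_mem_nhdsWithin
  obtain ⟨η, hη, hηκ⟩ := (hpos.and (eventually_mul_le (∑ i, 2 * C i) hκ)).exists
  refine ⟨η, hη, fun g hg hgb => ?_⟩
  have hm : ∀ i, ContDiff ℝ 1 (cubicMonomial (n := n) i) := fun i =>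
    (contDiff_cubicMonomial i).of_le (by simp)
  refine ⟨ContDiff.sum fun i _ => (hg i).mul (hm i), fun x hx => ?_⟩
  have hsq : 0 ≤ ‖x‖ ^ 2 := by positivity
  have hsum : ∀ a : CubicIndex n → ℝ, (∀ i, a i ≤ η * (2 * C i) * ‖x‖ ^ 2) →
      ∑ i, a i ≤ κ * ‖x‖ ^ 2 := by
    intro a ha
    refine (Finset.sum_le_sum fun i _ => ha i).trans ?_
    rw [← Finset.sum_mul, ← Finset.mul_sum]
    exact mul_le_mul_of_nonneg_right hηκ hsq
  constructor
  · refine (Finset.abs_sum_le_sum_abs _ _).trans (hsum _ fun i => ?_)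
    have h1 := mul_le_mul (hgb i x hx).1 (hC i x hx).1 (abs_nonneg _) hη.le
    have h2 : 0 ≤ η * C i * ‖x‖ ^ 2 := mul_nonneg (mul_nonneg hη.le (hC0 i)) hsq
    rw [abs_mul]
    linarith
  · have hd : HasFDerivAt (fun x => ∑ i, g i x * cubicMonomial i x)
        (∑ i, (g i x • fderiv ℝ (cubicMonomial i) x + cubicMonomial i x • fderiv ℝ (g i) x)) x :=
      HasFDerivAt.fun_sum fun i _ => ((hg i).differentiable one_ne_zero x).hasFDerivAt.mul
        ((hm i).differentiable one_ne_zero x).hasFDerivAt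
    rw [hd.fderiv]
    refine (norm_sum_le _ _).trans (hsum _ fun i => ?_)
    refine (norm_add_le _ _).trans ?_
    rw [norm_smul, norm_smul, Real.norm_eq_abs, Real.norm_eq_abs]
    have h1 := mul_le_mul (hgb i x hx).1 (hC i x hx).2 (norm_nonneg _) hη.le
    have h2 := mul_le_mul (hC i x hx).1 (hgb i x hx).2 (norm_nonneg _)
      (mul_nonneg (hC0 i) hsq)
    linarith

end TaylorNeural

open TaylorNeural

theorem mainTheorem1 (n : ℕ) (hn : 0 < n)
    (f : TaylorNeural.State n → TaylorNeural.State n)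
    (hf : ∃ K : NNReal, LipschitzWith K f) (hf₀ : f 0 = 0)
    (A : Matrix (Fin n) (Fin n) ℝ) (hA : TaylorNeural.HasStableLinearization f A)
    (ψ : ℝ → ℝ) (hψ : TaylorNeural.IsActivation ψ)
    (L : ℕ) (hL : 0 < L)
    (e : TaylorNeural.CubicIndex n → Fin (n ^ 3) → ℝ) (he : LinearIndependent ℝ e)
    (Vstar : TaylorNeural.State n → ℝ)
    (hV : TaylorNeural.IsMaximalLyapunovFunction f Vstar)
    (ε : ℝ) (hε : ε ∈ Set.Ioo (0 : ℝ) 1) :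
    ∃ (N : ℕ) (P : Matrix (Fin n) (Fin n) ℝ) (Θ : TaylorNeural.Parameters n N L),
      0 < N ∧ P.PosDef ∧ (-(Aᵀ * P + P * A)).PosDef ∧
      TaylorNeural.IsLyapunovFunction f (TaylorNeural.taylorNeural ψ e P Θ) ∧
      {x | x ∈ TaylorNeural.cube n ∧ Vstar x ≤ 1 - ε} ⊆
        TaylorNeural.basin (TaylorNeural.taylorNeural ψ e P Θ) ∧
      TaylorNeural.basin (TaylorNeural.taylorNeural ψ e P Θ) ⊆ TaylorNeural.basin Vstar := by
  obtain ⟨K, hK⟩ := hf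
  obtain ⟨P, hP, hAP, U, hU, hUc, ⟨ρ, hρ, hU0⟩, κ, hκ, hrobust⟩ :=
    exists_robust_lyapunov hn hK hf₀ hA hV hε
  obtain ⟨r, hr, hrc, hUr⟩ := exists_cubic_coefficients hU hUc hρ hU0
  obtain ⟨η, hη, hpert⟩ := exists_cubic_perturbation_bound (n := n) hκ
  obtain ⟨s, β, hsβ⟩ := exists_deepActivation_nonconstant hψ.nonconstant
  obtain ⟨C, hC⟩ := hψ.bounded 0 (by norm_num)
  simp only [iteratedDeriv_zero] at hC
  have hΨ := contDiff_deepActivation hψ.smooth s β L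
  choose c hc using fun i => exists_network_approx (n := n) hΨ
    ⟨C, abs_deepActivation_le hC s β L⟩ (hsβ L) (hr i) (hrc i) hη
  obtain ⟨N, Θ, hN, hΘ⟩ := exists_parameters ψ s β L he c
  have hg : ∀ i, ContDiff ℝ 1 fun x =>
      (∑ q ∈ (c i).support, c i q * deepActivation ψ s β L (inner ℝ q.1 x + q.2)) - r i x :=
    fun i => (ContDiff.sum fun q _ => contDiff_const.mul (contDiff_neuron hΨ q)).sub
      ((hr i).of_le (by simp))
  obtain ⟨hE, hEb⟩ := hpert _ hg hc
  have hVhat : taylorNeural ψ e P Θ = fun x => quadForm P x + U x + ∑ i,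
      ((∑ q ∈ (c i).support, c i q * deepActivation ψ s β L (inner ℝ q.1 x + q.2)) - r i x)
        * cubicMonomial i x := by
    ext x
    have h1 : taylorNeural ψ e P Θ x = quadForm P x
        + ∑ i, (residual ψ Θ x ⬝ᵥ e i) * cubicMonomial i x := rfl
    rw [h1, hUr, add_assoc, ← Finset.sum_add_distrib]
    congr 1
    refine Finset.sum_congr rfl fun i _ => ?_
    rw [hΘ]
    ring
  have hfin := hrobust _ hE hEb
  rw [← hVhat] at hfin
  exact ⟨N, P, Θ, hN, hP, hAP, hfin⟩
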